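/- Fix a sign. Consider on $\mathbb{R}^2$ the equation $$\partial_t u+\mathcal{H}_xu-\mathcal{H}_x\partial_x^2u\pm\mathcal{H}_x\partial_y^2u+u\,\partial_xu=0,\qquad u(\cdot,0)=u_0, \tag{1}$$ where $\widehat{\mathcal{H}_x\phi}(\xi,\eta)=-i\,\mathrm{sgn}(\xi)\widehat\phi(\xi,\eta)$ and $\widehat f(\xi,\eta)=\int f(x,y)e^{-i(x\xi+y\eta)}\,dx\,dy$. Solutions may be complex-valued, in particular real-valued. Let $$Z_{s,r_1,r_2}=H^s(\mathbb{R}^2)\cap L^2\big((|x|^{2r_1}+|y|^{2r_2})\,dx\,dy\big),$$ with the sum of the two norms, and, for $r_1>1/2$, let $\dot Z_{s,r_1,r_2}$ be the set of those $f\in Z_{s,r_1,r_2}$ with $\widehat f(0,\eta)=0$ for a.e. $\eta$ (where $\widehat f(\cdot,\eta)$ denotes, for a.e. $\eta$, its continuous representative). Theorem. Let $s>3$. There is $\varepsilon_0>0$, depending only on $s$, such that the following holds for all $r_1\in(3/2-\varepsilon_0,3/2)$ and all $r_2$ with $r_1\le r_2<s$. Let $u\in C([0,T];\dot Z_{s,r_1,r_2})$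 be a solution of (1) on $[0,T]$, and suppose there are times $t_1<t_2$ in $[0,T]$ and some $\kappa>0$ with $$u(\cdot,t_1)\in Z_{s,3/2+\kappa,r_2}\quad\text{and}\quad u(\cdot,t_2)\in Z_{s,3/2,r_2}.$$ Then, for a.e. $\eta\in\mathbb{R}$, $\widehat u(\cdot,\eta,t_1)$ is continuously differentiable in $\xi$ and $$2i\sin\big((1\mp\eta^2)(t_2-t_1)\big)\,\partial_\xi\widehat u(0,\eta,t_1)=-\int_{t_1}^{t_2}\sin\big((1\mp\eta^2)(t_2-t')\big)\,\widehat{u^2}(0,\eta,t')\,dt'.$$ If moreover $u(\cdot,t_1)\in Z_{s,\rho_1,\rho_2}$ for some $\rho_1>2$ and $\rho_2>2$, then $x\,u(\cdot,t_1)$ is integrable on $\mathbb{R}^2$ and $$2\sin(t_2-t_1)\int x\,u(x,y,t_1)\,dx\,dy=\big(\cos(t_2-t_1)-1\big)\int u_0^2(x,y)\,dx\,dy.$$ -/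

import Mathlib

open MeasureTheory Filter Set
open scoped Topology ENNReal FourierTransform

noncomputable section

/-- The Euclidean plane; `p 0` is the `x` (or `ξ`) coordinate and `p 1` the `y` (or `η`) one. -/
abbrev Plane : Type := EuclideanSpace ℝ (Fin 2)

/-- Complex-valued square integrable functions on the plane, modulo a.e. equality. -/
abbrev L2Plane : Type := Lp ℂ 2 (volume : Measure Plane)

/-- The Fourier transform of `f ∈ L²` with the normalization `f̂(ζ) = ∫ f(p) exp (-i p·ζ) dp`
(Mathlib's `𝓕` uses `exp (-2πi p·ζ)`, whence the dilation). It is defined up to null sets. -/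
def fourierHat (f : L2Plane) : Plane → ℂ :=
  fun ζ => (𝓕 f : L2Plane) ((2 * Real.pi)⁻¹ • ζ)

/-- The pointwise Fourier integral `ĝ(ξ, η) = ∫ g(x, y) exp (-i (x ξ + y η)) dx dy` of an
integrable function `g`. -/
def fourierIntegralAt (g : Plane → ℂ) (ξ η : ℝ) : ℂ :=
  ∫ p : Plane, Complex.exp (-(Complex.I * ((p 0 * ξ + p 1 * η : ℝ) : ℂ))) * g p

/-- The norm of `H^s` (for `s ≥ 0`): the `L²` norm of `⟨ζ⟩^s f̂(ζ)`, with values in `[0, ∞]`. -/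
def sobolevENorm (s : ℝ) (f : L2Plane) : ℝ≥0∞ :=
  eLpNorm (fun ζ : Plane => (((1 + ‖ζ‖ ^ 2) ^ (s / 2) : ℝ) : ℂ) * fourierHat f ζ) 2 volume

/-- The norm of `L²((|x|^{2 r₁} + |y|^{2 r₂}) dx dy)`, with values in `[0, ∞]`. -/
def weightedENorm (r₁ r₂ : ℝ) (f : L2Plane) : ℝ≥0∞ :=
  eLpNorm (f : Plane → ℂ) 2 ((volume : Measure Plane).withDensity
    (fun p => ENNReal.ofReal (|p 0| ^ (2 * r₁) + |p 1| ^ (2 * r₂))))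

/-- The norm of `Z_{s, r₁, r₂} = H^s ∩ L²((|x|^{2 r₁} + |y|^{2 r₂}) dx dy)`. -/
def zENorm (s r₁ r₂ : ℝ) (f : L2Plane) : ℝ≥0∞ :=
  sobolevENorm s f + weightedENorm r₁ r₂ f

/-- Membership in `Z_{s, r₁, r₂}`. -/
def MemZ (s r₁ r₂ : ℝ) (f : L2Plane) : Prop :=
  zENorm s r₁ r₂ f < ∞

/-- `G` is a pointwise representative of the Fourier transform of `f`. -/
def RepresentsHat (f : L2Plane) (G : ℝ → ℝ → ℂ) : Prop :=
  (fun ζ : Plane => G (ζ 0) (ζ 1)) =ᵐ[volume] fourierHat f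

/-- `f̂(0, η) = 0` for almost every `η`: the Fourier transform of `f` has a representative that is
continuous in `ξ` and vanishes at `ξ = 0`, for almost every `η`. -/
def HatVanishesAtZero (f : L2Plane) : Prop :=
  ∃ G : ℝ → ℝ → ℂ, RepresentsHat f G ∧
    ∀ᵐ η : ℝ, Continuous (fun ξ => G ξ η) ∧ G 0 η = 0

/-- `∂_ξ f̂(0, η) = g η` for almost every `η`: the Fourier transform of `f` has a representative
that, for almost every `η`, is continuously differentiable in `ξ` with derivative `g η` at `0`. -/
def HatXiDerivAtZero (f : L2Plane) (g : ℝ → ℂ) : Prop :=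
  ∃ G : ℝ → ℝ → ℂ, RepresentsHat f G ∧
    ∀ᵐ η : ℝ, ContDiff ℝ 1 (fun ξ => G ξ η) ∧ deriv (fun ξ => G ξ η) 0 = g η

/-- Membership in `Ż_{s, r₁, r₂}`, the functions of `Z_{s, r₁, r₂}` with `f̂(0, η) = 0`. -/
def MemZDot (s r₁ r₂ : ℝ) (f : L2Plane) : Prop :=
  MemZ s r₁ r₂ f ∧ HatVanishesAtZero f

/-- `u ∈ C([0, T]; Ż_{s, r₁, r₂})`. -/
def ContinuousIntoZDot (T s r₁ r₂ : ℝ) (u : ℝ → L2Plane) : Prop :=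
  ∀ t ∈ Icc 0 T, MemZDot s r₁ r₂ (u t) ∧
    Tendsto (fun t' => zENorm s r₁ r₂ (u t' - u t)) (𝓝[Icc 0 T] t) (𝓝 0)

/-- `g ∈ L²` is the image of `f ∈ L²` under the Fourier multiplier with symbol `m`. -/
def IsMultiplierImage (m : Plane → ℂ) (f g : L2Plane) : Prop :=
  fourierHat g =ᵐ[volume] fun ζ => m ζ * fourierHat f ζ

/-- The symbol `-i sgn ξ` of the Hilbert transform `H_x` in the `x` variable. -/
def hilbertSymbol (ζ : Plane) : ℂ :=
  -Complex.I * ((Real.sign (ζ 0) : ℝ) : ℂ)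

/-- The symbol `i ξ` of `∂_x` (for `j = 0`), or `i η` of `∂_y` (for `j = 1`). -/
def derivSymbol (j : Fin 2) (ζ : Plane) : ℂ :=
  Complex.I * ((ζ j : ℝ) : ℂ)

/-- `u` solves `∂_t u + H_x u - H_x ∂_x² u + σ H_x ∂_y² u + u ∂_x u = 0` on `[0, T]`: at each time
all the terms are functions in `L²`, the time derivative is taken in `L²` (one-sided at the
endpoints of `[0, T]`), and the equation holds in `L²`. -/
def IsSolution (σ T : ℝ) (u : ℝ → L2Plane) : Prop :=
  ∀ t ∈ Icc 0 T, ∃ hu hxx hyy ux uux : L2Plane,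
    IsMultiplierImage hilbertSymbol (u t) hu ∧
    IsMultiplierImage (fun ζ => hilbertSymbol ζ * derivSymbol 0 ζ ^ 2) (u t) hxx ∧
    IsMultiplierImage (fun ζ => hilbertSymbol ζ * derivSymbol 1 ζ ^ 2) (u t) hyy ∧
    IsMultiplierImage (derivSymbol 0) (u t) ux ∧
    (uux =ᵐ[volume] fun p => u t p * ux p) ∧
    HasDerivWithinAt u (-(hu - hxx + (σ : ℂ) • hyy + uux)) (Icc 0 T) t

end

/-! On the Fourier side the equation reads `∂_t û = i sgn(ξ) (1 + ξ² - σ η²) û - (i ξ / 2) (u²)^`.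
Hence on each half plane `±ξ > 0` Duhamel's formula holds with the smooth phase `±(1 + ξ² - σ η²)`,
and the sign change across `ξ = 0` tends to create a corner in `û(·, η, t)`, even if `û(·, η, t₁)`
is `C¹`. The two one-sided slopes at time `t₂` involve `exp(±i (1 - σ η²)(t₂ - t₁)) ∂_ξ û(0, η, t₁)`
and the corresponding integrals of `(u²)^(0, η, t')`; here `û(0, η, t) = 0` is used. The weight
`|x|^{3/2}` at time `t₂` is critical: it does not give differentiability, but it forces the
symmetric second difference of `û(·, η, t₂)` at `0` to be `o(ξ)`, which excludes a corner. Equating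
the slopes is the first identity (`jump_condition`).

The analytic inputs are `duhamel_ae` (Duhamel for an `L²`-valued curve, upgraded to every frequency
by `IsSolution.duhamel`), `exists_slices` (for a.e. `η`, `û(·, η)` is the transform of a function of
`x` that keeps the weight in `x`) and `fourier_second_difference_isLittleO`.

For the second identity, integrability of `x u(t₁)` makes both sides continuous in `η`, so `η = 0`
may be inserted. There `(u²)^(0, 0, t') = ∫ u²`, which is conserved (`IsSolution.integral_sq_eq`),
the sine integrates to `1 - cos(t₂ - t₁)`, and `∂_ξ û(0, 0, t₁) = -i ∫ x u(t₁)`. -/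

noncomputable section

/-! ### The `L²` Fourier transform against the Fourier integral -/

section Fourier

variable {V : Type*} [NormedAddCommGroup V] [InnerProductSpace ℝ V] [FiniteDimensional ℝ V]
  [MeasurableSpace V] [BorelSpace V]

theorem continuous_fourier_of_integrable {f : V → ℂ} (hf : Integrable f) : Continuous (𝓕 f) :=
  VectorFourier.fourierIntegral_continuous Real.continuous_fourierChar
    (innerSL ℝ).continuous₂ hf

theorem norm_fourier_le_of_integrable (f : V → ℂ) (w : V) : ‖𝓕 f w‖ ≤ ∫ x, ‖f x‖ :=
  VectorFourier.norm_fourierIntegral_le_integral_norm _ _ _ _ _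

/-- The `L²` Fourier transform of an integrable function is given by the Fourier integral. -/
theorem fourier_Lp_ae_eq (f : Lp ℂ 2 (volume : Measure V)) (hf : Integrable (f : V → ℂ)) :
    ((𝓕 f : Lp ℂ 2 (volume : Measure V)) : V → ℂ) =ᵐ[volume] 𝓕 (f : V → ℂ) := by
  apply ae_eq_of_integral_contDiff_smul_eq
  · exact (Lp.memLp _).locallyIntegrable (by norm_num)
  · exact (continuous_fourier_of_integrable hf).locallyIntegrable
  intro g g_smooth g_cpt
  have hg₁ : HasCompactSupport (Complex.ofRealCLM ∘ g) := g_cpt.comp_left rfl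
  have hg₂ : ContDiff ℝ (⊤ : ℕ∞) (Complex.ofRealCLM ∘ g) := by fun_prop
  set φ := hg₁.toSchwartzMap hg₂ with hφ
  -- Tested against `φ`, both candidates equal `∫ 𝓕 φ · f`: `h1` by duality of tempered
  -- distributions, `h2` by Fubini for integrable functions.
  have h1 := congrArg (fun T : TemperedDistribution V ℂ => T φ) (Lp.fourier_toTemperedDistribution_eq f)
  simp only [TemperedDistribution.fourier_apply, Lp.toTemperedDistribution_apply] at h1
  have h2 := VectorFourier.integral_fourierIntegral_smul_eq_flip (L := innerₗ V) 
    Real.continuous_fourierChar (by exact (innerSL ℝ).continuous₂) (φ.integrable (μ := volume)) hf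
  rw [flip_innerₗ] at h2
  have e : ∀ x, g x • ((𝓕 f : Lp ℂ 2 (volume : Measure V)) : V → ℂ) x = φ x • ((𝓕 f : Lp ℂ 2 (volume : Measure V)) : V → ℂ) x := by
    intro x; simp [hφ]
  have e' : ∀ x, g x • 𝓕 (f : V → ℂ) x = φ x • 𝓕 (f : V → ℂ) x := by
    intro x; simp [hφ]
  simp_rw [e, e']
  rw [← h1]
  exact (by simp only [SchwartzMap.fourier_coe]; exact h2)

theorem fourierInv_Lp_ae_eq (f : Lp ℂ 2 (volume : Measure V)) (hf : Integrable (f : V → ℂ)) :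
    ((𝓕⁻ f : Lp ℂ 2 (volume : Measure V)) : V → ℂ) =ᵐ[volume] 𝓕⁻ (f : V → ℂ) := by
  have hc : Continuous (𝓕⁻ (f : V → ℂ)) := by
    have : 𝓕⁻ (f : V → ℂ) = fun x => 𝓕 (f : V → ℂ) (-x) := by
      ext x; exact Real.fourierInv_eq_fourier_neg _ _
    rw [this]
    exact (continuous_fourier_of_integrable hf).comp continuous_neg
  apply ae_eq_of_integral_contDiff_smul_eq
  · exact (Lp.memLp _).locallyIntegrable (by norm_num)
  · exact hc.locallyIntegrable
  intro g g_smooth g_cpt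
  have hg₁ : HasCompactSupport (Complex.ofRealCLM ∘ g) := g_cpt.comp_left rfl
  have hg₂ : ContDiff ℝ (⊤ : ℕ∞) (Complex.ofRealCLM ∘ g) := by fun_prop
  set φ := hg₁.toSchwartzMap hg₂ with hφ
  have h1 := congrArg (fun T : TemperedDistribution V ℂ => T φ)
    (Lp.fourierInv_toTemperedDistribution_eq f)
  simp only [TemperedDistribution.fourierInv_apply, Lp.toTemperedDistribution_apply] at h1
  have h2 := VectorFourier.integral_fourierIntegral_smul_eq_flip (L := -innerₗ V)
    Real.continuous_fourierChar (by exact (innerSL ℝ).continuous₂.neg) (φ.integrable (μ := volume)) hf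
  have e0 : (-innerₗ V).flip = -innerₗ V := by
    ext x y; simp [real_inner_comm]
  rw [e0] at h2
  have e : ∀ x, g x • ((𝓕⁻ f : Lp ℂ 2 (volume : Measure V)) : V → ℂ) x = φ x • ((𝓕⁻ f : Lp ℂ 2 (volume : Measure V)) : V → ℂ) x := by
    intro x; simp [hφ]
  have e' : ∀ x, g x • 𝓕⁻ (f : V → ℂ) x = φ x • 𝓕⁻ (f : V → ℂ) x := by
    intro x; simp [hφ]
  simp_rw [e, e']
  rw [← h1]
  simp only [SchwartzMap.fourierInv_coe]
  refine Eq.trans ?_ (h2.trans ?_)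
  · rfl
  · rfl

/-- Plancherel's theorem for functions in `L¹ ∩ L²`. -/
theorem eLpNorm_fourier_eq {f : V → ℂ} (hf : Integrable f) (hf2 : MemLp f 2) :
    eLpNorm (𝓕 f) 2 volume = eLpNorm f 2 volume := by
  have hae := hf2.coeFn_toLp
  have h1 : Integrable (hf2.toLp f : V → ℂ) := hf.congr hae.symm
  have h2 := fourier_Lp_ae_eq _ h1
  have h3 : 𝓕 (hf2.toLp f : V → ℂ) = 𝓕 f := by
    ext x; exact Real.fourier_congr_ae hae x
  rw [h3] at h2
  rw [← eLpNorm_congr_ae h2, ← eLpNorm_congr_ae hae]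
  have := Lp.norm_fourier_eq (hf2.toLp f)
  rw [Lp.norm_def, Lp.norm_def] at this
  exact (ENNReal.toReal_eq_toReal_iff' (Lp.eLpNorm_ne_top _) (Lp.eLpNorm_ne_top _)).1 this

/-- The Fourier transform of a product is the convolution of the Fourier transforms. -/
theorem fourier_mul_eq_integral {f : V → ℂ} (hf : Integrable f) (hf2 : MemLp f 2)
    (g : Lp ℂ 2 (volume : Measure V)) (w : V) :
    𝓕 (fun x => f x * g x) w =
      ∫ z, 𝓕 f (w - z) * (𝓕 g : Lp ℂ 2 (volume : Measure V)) z := by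
  -- The modulated conjugate is chosen so that `⟪h, g⟫` is the left side, while `𝓕 h z` is the
  -- conjugate of `𝓕 f (w - z)`; Plancherel's identity then is the claim.
  set h : V → ℂ := fun x => (starRingEnd ℂ) (Real.fourierChar (-inner ℝ x w) • f x) with hh
  have hfe : Integrable (fun x => Real.fourierChar (-inner ℝ x w) • f x) :=
    (Real.fourierIntegral_convergent_iff w).2 hf
  have hint : Integrable h := 
    (Complex.conjCLE.toContinuousLinearMap).integrable_comp hfe
  have hn : ∀ x, ‖h x‖ = ‖f x‖ := by
    intro x; rw [hh]; simp only [RCLike.norm_conj, Circle.norm_smul]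
  have h2 : MemLp h 2 := hf2.congr_norm hint.1 (Eventually.of_forall fun x => (hn x).symm)
  have hFh : ∀ z, 𝓕 h z = (starRingEnd ℂ) (𝓕 f (w - z)) := by
    intro z
    rw [Real.fourier_eq, Real.fourier_eq, ← integral_conj]
    congr 1; ext x
    simp only [hh, Circle.smul_def, smul_eq_mul, map_mul, inner_sub_right]
    rw [← mul_assoc]
    congr 1
    simp only [Real.fourierChar_apply, ← Complex.exp_conj, ← Complex.exp_add]
    congr 1
    simp [Complex.conj_ofNat]
    ring
  have hae := h2.coeFn_toLp
  have h1' : Integrable (h2.toLp h : V → ℂ) := hint.congr hae.symm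
  have hF := fourier_Lp_ae_eq _ h1'
  have h3 : 𝓕 (h2.toLp h : V → ℂ) = 𝓕 h := by
    ext x; exact Real.fourier_congr_ae hae x
  rw [h3] at hF
  have key := Lp.inner_fourier_eq (h2.toLp h) g
  rw [L2.inner_def, L2.inner_def] at key
  rw [Real.fourier_eq]
  calc _ = ∫ a, inner ℂ ((h2.toLp h : V → ℂ) a) (g a) := by
        apply integral_congr_ae
        filter_upwards [hae] with x hx
        rw [hx, RCLike.inner_apply]
        simp only [hh, Circle.smul_def, smul_eq_mul, Complex.conj_conj]
        ring
    _ = _ := by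
        rw [← key]
        apply integral_congr_ae
        filter_upwards [hF] with z hz
        rw [hz, hFh, RCLike.inner_apply]
        simp only [Complex.conj_conj]
        ring

end Fourier

/-! ### Multipliers, products and conservation of `∫ u²` -/

theorem two_pi_pos : (0 : ℝ) < 2 * Real.pi := by positivity

theorem MemLp.integrable_mul_two {α : Type*} [MeasurableSpace α] {μ : Measure α} {f g : α → ℂ}
    (hf : MemLp f 2 μ) (hg : MemLp g 2 μ) : Integrable (fun x => f x * g x) μ :=
  memLp_one_iff_integrable.1 (MemLp.mul (r := 1) hg hf)

theorem ae_comp_smul_iff {E : Type*} [NormedAddCommGroup E] [InnerProductSpace ℝ E]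
    [FiniteDimensional ℝ E] [MeasurableSpace E] [BorelSpace E] {c : ℝ} (hc : c ≠ 0) {P : E → Prop} :
    (∀ᵐ z : E, P (c • z)) ↔ ∀ᵐ z : E, P z := by
  have key : ∀ {c : ℝ}, c ≠ 0 → ∀ {P : E → Prop}, (∀ᵐ z : E, P z) → ∀ᵐ z : E, P (c • z) := by
    intro c hc P h
    rw [ae_iff] at h ⊢
    have : {a : E | ¬P (c • a)} = (fun z => c • z) ⁻¹' {a | ¬ P a} := rfl
    rw [this, Measure.addHaar_preimage_smul _ hc, h, mul_zero]
  refine ⟨fun h => ?_, key hc⟩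
  have := key (inv_ne_zero hc) h
  simpa [smul_smul, mul_inv_cancel₀ hc] using this

theorem fourierHat_smul (f : L2Plane) (z : Plane) :
    fourierHat f ((2 * Real.pi) • z) = (𝓕 f : L2Plane) z := by
  rw [fourierHat, smul_smul, inv_mul_cancel₀ two_pi_pos.ne', one_smul]

theorem isMultiplierImage_iff {m : Plane → ℂ} {f g : L2Plane} :
    IsMultiplierImage m f g ↔
      ∀ᵐ z : Plane, (𝓕 g : L2Plane) z = m ((2 * Real.pi) • z) * (𝓕 f : L2Plane) z := by
  unfold IsMultiplierImage
  rw [EventuallyEq, ← ae_comp_smul_iff two_pi_pos.ne']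
  simp only [fourierHat_smul]

theorem fourier_coe_mul (f g : L2Plane) {uv : L2Plane}
    (h : uv =ᵐ[volume] fun p => f p * g p) : 𝓕 (uv : Plane → ℂ) = 𝓕 (fun p => f p * g p) := by
  ext w; exact Real.fourier_congr_ae h w

theorem integrable_coe_mul (f g : L2Plane) : Integrable (fun p => f p * g p) :=
  MemLp.integrable_mul_two (Lp.memLp f) (Lp.memLp g)

/-- `∂_x (u²) = 2 u ∂_x u` on the Fourier side. -/
theorem fourier_mul_deriv {u ux : L2Plane} (hu : Integrable (u : Plane → ℂ))
    (hux : IsMultiplierImage (derivSymbol 0) u ux) (w : Plane) :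
    𝓕 (fun p => u p * ux p) w =
      Real.pi * Complex.I * ((w 0 : ℝ) : ℂ) * 𝓕 (fun p => u p * u p) w := by
  set U : Plane → ℂ := 𝓕 (u : Plane → ℂ) with hU
  have hUae := fourier_Lp_ae_eq u hu
  have hU2 : MemLp U 2 := (memLp_congr_ae hUae).1 (Lp.memLp _)
  set W : Plane → ℂ := fun z => 2 * Real.pi * Complex.I * ((z 0 : ℝ) : ℂ) * U z with hW
  have hWae : ((𝓕 ux : L2Plane) : Plane → ℂ) =ᵐ[volume] W := by
    filter_upwards [isMultiplierImage_iff.1 hux, hUae] with z hz hz'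
    rw [hz, hz', hW, derivSymbol]
    simp
    ring
  have hW2 : MemLp W 2 := (memLp_congr_ae hWae).1 (Lp.memLp _)
  have hUw : MemLp (fun z => U (w - z)) 2 :=
    hU2.comp_measurePreserving (Measure.measurePreserving_sub_left volume w)
  have hWw : MemLp (fun z => W (w - z)) 2 :=
    hW2.comp_measurePreserving (Measure.measurePreserving_sub_left volume w)
  have e1 : 𝓕 (fun p => u p * ux p) w = ∫ z, U (w - z) * W z := by
    rw [fourier_mul_eq_integral hu (Lp.memLp u)]
    apply integral_congr_ae
    filter_upwards [hWae] with z hz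
    rw [hz]
  have e2 : 𝓕 (fun p => u p * ux p) w = ∫ z, U z * W (w - z) := by
    rw [e1, ← integral_sub_left_eq_self _ volume w]
    simp
  have e3 : 𝓕 (fun p => u p * u p) w = ∫ z, U (w - z) * U z := by
    rw [fourier_mul_eq_integral hu (Lp.memLp u)]
    apply integral_congr_ae
    filter_upwards [hUae] with z hz
    rw [hz]
  -- Averaging the convolution with its reflection `z ↦ w - z` replaces the factor `z 0` by `z 0 +
  -- (w 0 - z 0) = w 0`, which leaves the integral.
  have e4 : 𝓕 (fun p => u p * ux p) w + 𝓕 (fun p => u p * ux p) w =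
      2 * (Real.pi * Complex.I * ((w 0 : ℝ) : ℂ) * 𝓕 (fun p => u p * u p) w) := by
    nth_rw 1 [e1]
    rw [e2, e3, ← integral_add (MemLp.integrable_mul_two hUw hW2)
      (MemLp.integrable_mul_two hU2 hWw), ← integral_const_mul, ← integral_const_mul]
    congr 1; ext z
    simp [hW]
    ring
  linear_combination (1 / 2) * e4

/-- A Fourier multiplier with an odd symbol is antisymmetric for the bilinear pairing. -/
theorem integral_mul_oddMultiplier {m : Plane → ℂ} (hm : ∀ ζ, m (-ζ) = -m ζ) {u g : L2Plane}
    (hu : Integrable (u : Plane → ℂ)) (hg : IsMultiplierImage m u g) :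
    ∫ p, u p * g p = 0 := by
  have e1 := fourier_mul_eq_integral hu (Lp.memLp u) g 0
  have hUae := fourier_Lp_ae_eq u hu
  have e2 : ∫ p, u p * g p = 𝓕 (fun p => u p * g p) 0 := by
    rw [Real.fourier_eq]; simp
  have e3 : ∫ p, u p * g p = ∫ z, 𝓕 (u : Plane → ℂ) (-z) *
      (m ((2 * Real.pi) • z) * 𝓕 (u : Plane → ℂ) z) := by
    rw [e2, e1]
    apply integral_congr_ae
    filter_upwards [hUae, isMultiplierImage_iff.1 hg] with z hz hz'
    rw [hz', hz, zero_sub]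
  have e4 : ∫ p, u p * g p = - ∫ p, u p * g p := by
    nth_rw 1 [e3]
    rw [← integral_neg_eq_self, e3, ← integral_neg]
    congr 1; ext z
    rw [smul_neg, hm, neg_neg]
    ring
  exact self_eq_neg.1 e4

/-- Formally the integrand is `∂_x (u³) / 3`. To avoid integrating by parts, the integral `I` is
computed by Plancherel in two groupings, `u · (u u_x)` and `u² · u_x`; after `z ↦ -z` these give `I
= -2 I`. -/
theorem integral_sq_mul_deriv {u ux uux : L2Plane} (hu : Integrable (u : Plane → ℂ))
    (hu4 : MemLp (fun p => u p * u p) 2)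
    (hux : IsMultiplierImage (derivSymbol 0) u ux) (huux : uux =ᵐ[volume] fun p => u p * ux p) :
    ∫ p, u p * uux p = 0 := by
  set U : Plane → ℂ := 𝓕 (u : Plane → ℂ) with hU
  set Q : Plane → ℂ := 𝓕 (fun p => u p * u p) with hQ
  have hUae := fourier_Lp_ae_eq u hu
  have i1 : Integrable (uux : Plane → ℂ) := (integrable_coe_mul u ux).congr huux.symm
  have a1 : ∫ p, u p * uux p = ∫ z : Plane, U (-z) * (Real.pi * Complex.I * ((z 0 : ℝ) : ℂ) * Q z) := by
    have e1 := fourier_mul_eq_integral hu (Lp.memLp u) uux 0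
    have e2 : ∫ p, u p * uux p = 𝓕 (fun p => u p * uux p) 0 := by
      rw [Real.fourier_eq]; simp
    rw [e2, e1]
    apply integral_congr_ae
    filter_upwards [fourier_Lp_ae_eq uux i1] with z hz
    rw [hz, fourier_coe_mul _ _ huux, fourier_mul_deriv hu hux, zero_sub]
  have a2 : ∫ p, u p * uux p = ∫ z : Plane, Q (-z) * (2 * Real.pi * Complex.I * ((z 0 : ℝ) : ℂ) * U z) := by
    have e1 := fourier_mul_eq_integral (integrable_coe_mul u u) hu4 ux 0
    have e2 : ∫ p, u p * uux p = 𝓕 (fun p => (u p * u p) * ux p) 0 := by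
      rw [Real.fourier_eq]
      simp only [inner_zero_right, neg_zero, AddChar.map_zero_eq_one, one_smul]
      apply integral_congr_ae
      filter_upwards [huux] with p hp
      rw [hp]; ring
    rw [e2, e1]
    apply integral_congr_ae
    filter_upwards [isMultiplierImage_iff.1 hux, hUae] with z hz hz'
    rw [hz, hz', zero_sub, derivSymbol]
    simp only [PiLp.smul_apply, smul_eq_mul, Complex.ofReal_mul, Complex.ofReal_ofNat]
    ring
  have a3 : ∫ p, u p * uux p = -2 * ∫ p, u p * uux p := by
    nth_rw 1 [a2]
    rw [a1, ← integral_neg_eq_self, ← integral_const_mul]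
    congr 1; ext z
    simp
    ring
  linear_combination (1 / 3) * a3

/-- The bilinear pairing `(f, g) ↦ ∫ f g` on `L²`. -/
def pairing2 : L2Plane →L[ℂ] L2Plane →L[ℂ] ℂ :=
  (ContinuousLinearMap.mul ℂ ℂ).lpPairing volume 2 2

theorem pairing2_apply (f g : L2Plane) : pairing2 f g = ∫ p, f p * g p := by
  rw [pairing2, ContinuousLinearMap.lpPairing_eq_integral]; rfl

/-- The Sobolev embedding of `H^s` into `L^∞`: the Fourier transform is integrable. -/
theorem integrable_fourier_of_sobolev {s : ℝ} (hs : 1 < s) {u : L2Plane}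
    (h : sobolevENorm s u < ∞) : Integrable ((𝓕 u : L2Plane) : Plane → ℂ) := by
  have m0 : AEStronglyMeasurable (fourierHat u) := by
    have : Measure.QuasiMeasurePreserving (fun z : Plane => (2 * Real.pi)⁻¹ • z) volume volume := by
      refine ⟨by fun_prop, ?_⟩
      refine Measure.AbsolutelyContinuous.mk fun t ht h0 => ?_
      rw [Measure.map_apply (by fun_prop) ht, Measure.addHaar_preimage_smul _ (by positivity), h0, mul_zero]
    exact (Lp.aestronglyMeasurable (𝓕 u : L2Plane)).comp_quasiMeasurePreserving this
  have m1 : MemLp (fun ζ : Plane => (((1 + ‖ζ‖ ^ 2) ^ (s / 2) : ℝ) : ℂ) * fourierHat u ζ) 2 := by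
    refine ⟨AEStronglyMeasurable.mul ?_ m0, h⟩
    apply Continuous.aestronglyMeasurable
    refine Complex.continuous_ofReal.comp (Continuous.rpow_const (by fun_prop) ?_)
    intro x; left; positivity
  -- Cauchy–Schwarz: `⟨ζ⟩^(-s)` is square integrable in dimension two because `2 s > 2`.
  have m2 : MemLp (fun ζ : Plane => (((1 + ‖ζ‖ ^ 2) ^ (-s / 2) : ℝ) : ℂ)) 2 := by
    rw [memLp_two_iff_integrable_sq_norm]
    · have := integrable_rpow_neg_one_add_norm_sq (E := Plane) (μ := volume) (r := 2 * s)
        (by simp; linarith)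
      refine this.congr (Eventually.of_forall fun x => ?_)
      simp only [Complex.norm_real, Real.norm_eq_abs, sq_abs]
      rw [← Real.rpow_mul_natCast (by positivity)]
      congr 1; push_cast; ring
    · apply Continuous.aestronglyMeasurable
      refine Complex.continuous_ofReal.comp (Continuous.rpow_const (by fun_prop) ?_)
      intro x; left; positivity
  have m3 : Integrable (fourierHat u) := by
    refine (MemLp.integrable_mul_two m2 m1).congr (Eventually.of_forall fun x => ?_)
    have : (0 : ℝ) < 1 + ‖x‖ ^ 2 := by positivity
    simp only
    rw [← mul_assoc, ← Complex.ofReal_mul, ← Real.rpow_add this]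
    simp [show -s / 2 + s / 2 = 0 by ring]
  have := m3.comp_smul (R := 2 * Real.pi) two_pi_pos.ne'
  simpa only [fourierHat_smul] using this

/-- By Fourier inversion `u` is bounded by the `L¹` norm of its transform, so `|u²| ≤ C |u|`. -/
theorem memLp_mul_self_of_sobolev {s : ℝ} (hs : 1 < s) {u : L2Plane}
    (h : sobolevENorm s u < ∞) : MemLp (fun p => u p * u p) 2 := by
  have h1 := integrable_fourier_of_sobolev hs h
  have h2 := fourierInv_Lp_ae_eq _ h1
  rw [FourierTransform.fourierInv_fourier_eq] at h2
  set C := ∫ z, ‖(𝓕 u : L2Plane) z‖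
  refine ((Lp.memLp u).norm.const_mul C).mono ?_ ?_
  · exact (Lp.aestronglyMeasurable u).mul (Lp.aestronglyMeasurable u)
  filter_upwards [h2] with p hp
  rw [norm_mul]
  have : ‖u p‖ ≤ C := by
    rw [hp, Real.fourierInv_eq_fourier_neg]
    exact norm_fourier_le_of_integrable _ _
  calc _ ≤ C * ‖u p‖ := by gcongr
    _ ≤ _ := by simpa using mul_le_mul_of_nonneg_right (le_abs_self C) (norm_nonneg (u p))

theorem hilbertSymbol_neg (ζ : Plane) : hilbertSymbol (-ζ) = -hilbertSymbol ζ := by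
  simp [hilbertSymbol, Real.sign_neg]

theorem derivSymbol_neg (j : Fin 2) (ζ : Plane) : derivSymbol j (-ζ) = -derivSymbol j ζ := by
  simp [derivSymbol]

/-- Conservation of `∫ u²`. -/
theorem IsSolution.integral_sq_eq {σ T s : ℝ} {u : ℝ → L2Plane} (hu : IsSolution σ T u)
    (hs : 1 < s) (hi : ∀ t ∈ Icc 0 T, Integrable (u t : Plane → ℂ))
    (hsob : ∀ t ∈ Icc 0 T, sobolevENorm s (u t) < ∞) {t : ℝ} (ht : t ∈ Icc 0 T) :
    ∫ p, u t p * u t p = ∫ p, u 0 p * u 0 p := by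
  -- The pairing is bilinear, without conjugation, since `u` may be complex and the conserved
  -- quantity is `∫ u²`, not `∫ |u|²`. Odd symbols kill the linear terms.
  have hd : ∀ t ∈ Icc 0 T, HasDerivWithinAt (fun t => pairing2 (u t) (u t)) 0 (Icc 0 T) t := by
    intro t ht
    obtain ⟨h, hxx, hyy, ux, uux, h1, h2, h3, h4, h5, h6⟩ := hu t ht
    have := (pairing2.bilinearRestrictScalars ℝ).hasDerivWithinAt_of_bilinear h6 h6
    simp only [ContinuousLinearMap.bilinearRestrictScalars_apply_apply] at this
    have z1 : pairing2 (u t) h = 0 := by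
      rw [pairing2_apply]
      exact integral_mul_oddMultiplier hilbertSymbol_neg (hi t ht) h1
    have z2 : pairing2 (u t) hxx = 0 := by
      rw [pairing2_apply]
      refine integral_mul_oddMultiplier ?_ (hi t ht) h2
      intro ζ; simp [hilbertSymbol_neg, derivSymbol_neg]
    have z3 : pairing2 (u t) hyy = 0 := by
      rw [pairing2_apply]
      refine integral_mul_oddMultiplier ?_ (hi t ht) h3
      intro ζ; simp [hilbertSymbol_neg, derivSymbol_neg]
    have z4 : pairing2 (u t) uux = 0 := by
      rw [pairing2_apply]
      exact integral_sq_mul_deriv (hi t ht) (memLp_mul_self_of_sobolev hs (hsob t ht)) h4 h5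
    have comm : ∀ f g, pairing2 f g = pairing2 g f := by
      intro f g
      rw [pairing2_apply, pairing2_apply]
      simp_rw [mul_comm]
    have z : pairing2 (u t) (-(h - hxx + (σ : ℂ) • hyy + uux)) = 0 := by
      simp [z1, z2, z3, z4]
    rw [comm _ (u t), z, add_zero] at this
    exact this
  have := constant_of_has_deriv_right_zero (a := 0) (b := T)
    (f := fun t => pairing2 (u t) (u t)) (fun t ht => (hd t ht).continuousWithinAt)
    (fun x hx => (hd x ⟨hx.1, hx.2.le⟩).mono_of_mem_nhdsWithin (Icc_mem_nhdsGE_of_mem hx)) t ht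
  simpa only [pairing2_apply] using this

/-! ### Duhamel's formula for curves in `L²` -/

section Duhamel

/-- The unimodular factor `exp (-i θ t)`. -/
def phase (θ : Plane → ℝ) (t : ℝ) (z : Plane) : ℂ :=
  Complex.exp (-(Complex.I * ((θ z * t : ℝ) : ℂ)))

theorem norm_phase (θ : Plane → ℝ) (t : ℝ) (z : Plane) : ‖phase θ t z‖ = 1 := by
  rw [phase, ← mul_neg, ← Complex.ofReal_neg, mul_comm]
  exact Complex.norm_exp_ofReal_mul_I _

theorem measurable_phase {θ : Plane → ℝ} (hθ : Measurable θ) :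
    Measurable (fun q : ℝ × Plane => phase θ q.1 q.2) := by
  unfold phase; fun_prop

theorem memLp_indicator_of_bound {A : Set Plane} (hA : MeasurableSet A) (hA' : volume A ≠ ∞)
    {f : Plane → ℂ} (hf : Measurable f) {C : ℝ} (hC : ∀ z ∈ A, ‖f z‖ ≤ C) :
    MemLp (A.indicator f) 2 (volume : Measure Plane) := by
  refine (memLp_indicator_const (μ := (volume : Measure Plane)) 2 hA (C : ℂ) (Or.inr hA')).mono
    (hf.indicator hA).aestronglyMeasurable (Eventually.of_forall fun z => ?_)
  by_cases hz : z ∈ A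
  · simp only [indicator_of_mem hz, Complex.norm_real]
    exact (hC z hz).trans (le_abs_self _)
  · simp [indicator_of_notMem hz]

/-- Differentiability in `L²` of the truncated unitary group. -/
theorem hasDerivAt_phase_toLp {A : Set Plane} (hA : MeasurableSet A) (hA' : volume A ≠ ∞)
    {θ : Plane → ℝ} {C : ℝ} (hC : ∀ z ∈ A, |θ z| ≤ C)
    (hE : ∀ t, MemLp (A.indicator (phase θ t)) 2 (volume : Measure Plane))
    (hE' : ∀ t, MemLp (A.indicator (fun z => -(Complex.I * θ z) * phase θ t z)) 2
      (volume : Measure Plane)) (t : ℝ) :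
    HasDerivAt (fun t => (hE t).toLp) ((hE' t).toLp) t := by
  have h1 : MemLp (A.indicator (fun _ => (1 : ℂ))) 2 (volume : Measure Plane) :=
    memLp_indicator_const 2 hA 1 (Or.inr hA')
  set C' := |C| + 1 with hC'
  have hC'pos : 0 < C' := by positivity
  rw [hasDerivAt_iff_isLittleO_nhds_zero]
  -- On `A` the phase speed is bounded, so `|e^w - 1 - w| ≤ |w|²` for `|w| ≤ 1` gives a remainder of
  -- size `h²`, uniformly in `z`. Truncation to `A` is what allows an unbounded `θ`.
  have hO : (fun h : ℝ => (hE (t + h)).toLp - (hE t).toLp - h • (hE' t).toLp) =O[𝓝 0]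
      fun h : ℝ => h ^ 2 := by
    refine Asymptotics.IsBigO.of_bound (C' ^ 2 * ‖h1.toLp‖) ?_
    have hsm : ∀ᶠ h : ℝ in 𝓝 0, |h| < C'⁻¹ := by
      have := Metric.ball_mem_nhds (0 : ℝ) (inv_pos.2 hC'pos)
      filter_upwards [this] with h hh
      simpa [Real.norm_eq_abs] using hh
    filter_upwards [hsm] with h hh
    have hb : ‖(hE (t + h)).toLp - (hE t).toLp - h • (hE' t).toLp‖ ≤
        (C' ^ 2 * h ^ 2) * ‖h1.toLp‖ := by
      apply Lp.norm_le_mul_norm_of_ae_le_mul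
      filter_upwards [(hE (t + h)).coeFn_toLp, (hE t).coeFn_toLp, (hE' t).coeFn_toLp,
        h1.coeFn_toLp, Lp.coeFn_sub ((hE (t + h)).toLp - (hE t).toLp) (h • (hE' t).toLp),
        Lp.coeFn_sub (hE (t + h)).toLp (hE t).toLp, Lp.coeFn_smul h (hE' t).toLp]
        with z e1 e2 e3 e4 e5 e6 e7
      rw [e5, Pi.sub_apply, e6, Pi.sub_apply, e7, Pi.smul_apply, e1, e2, e3, e4]
      by_cases hz : z ∈ A
      · simp only [indicator_of_mem hz, norm_one, mul_one]
        set w : ℂ := -(Complex.I * ((θ z * h : ℝ) : ℂ)) with hw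
        have hwn : ‖w‖ = |θ z| * |h| := by
          rw [hw, norm_neg, norm_mul, Complex.norm_I, one_mul, Complex.norm_real,
            Real.norm_eq_abs, abs_mul]
        have hθC : |θ z| ≤ C' := (hC z hz).trans (by rw [hC']; linarith [le_abs_self C])
        have hw1 : ‖w‖ ≤ 1 := by
          rw [hwn]
          calc |θ z| * |h| ≤ C' * C'⁻¹ := by gcongr
            _ = 1 := mul_inv_cancel₀ hC'pos.ne'
        have hsplit : phase θ (t + h) z = phase θ t z * Complex.exp w := by
          rw [phase, phase, hw, ← Complex.exp_add]
          congr 1; push_cast; ring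
        have : phase θ (t + h) z - phase θ t z - h • (-(Complex.I * θ z) * phase θ t z) =
            phase θ t z * (Complex.exp w - 1 - w) := by
          rw [hsplit, hw, Complex.real_smul]; push_cast; ring
        rw [this, norm_mul, norm_phase, one_mul]
        calc _ ≤ ‖w‖ ^ 2 := Complex.norm_exp_sub_one_sub_id_le hw1
          _ = |θ z| ^ 2 * h ^ 2 := by rw [hwn, mul_pow, sq_abs h]
          _ ≤ _ := by gcongr
      · simp [indicator_of_notMem hz]
    refine hb.trans (le_of_eq ?_)
    rw [Real.norm_eq_abs, abs_of_nonneg (sq_nonneg h)]; ring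
  refine hO.trans_isLittleO ?_
  have := Asymptotics.isLittleO_pow_pow (𝕜 := ℝ) (show 1 < 2 by norm_num)
  simpa using this

/-- An `L²` derivative says nothing about `t ↦ v t z` at a fixed `z`. The formula is therefore
integrated over arbitrary measurable subsets of a ball, where the fundamental theorem of calculus
and Fubini apply; these integrals determine the functions a.e. -/
theorem duhamel_ae {θ : Plane → ℝ} (hθ : Measurable θ)
    (hθb : ∀ R : ℝ, ∃ C, ∀ z : Plane, ‖z‖ ≤ R → |θ z| ≤ C)
    {v : ℝ → L2Plane} {N : ℝ → Plane → ℂ} (hN : Continuous (Function.uncurry N)) {T : ℝ}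
    (hv : ∀ t ∈ Icc 0 T, ∃ v' : L2Plane, HasDerivWithinAt v v' (Icc 0 T) t ∧
      v' =ᵐ[volume] fun z => Complex.I * θ z * v t z + N t z)
    {t₁ t₂ : ℝ} (h₁ : t₁ ∈ Icc 0 T) (h₂ : t₂ ∈ Icc 0 T) (h₁₂ : t₁ ≤ t₂) :
    ∀ᵐ z : Plane, phase θ t₂ z * v t₂ z - phase θ t₁ z * v t₁ z =
      ∫ t in t₁..t₂, phase θ t z * N t z := by
  suffices H : ∀ n : ℕ, ∀ᵐ z : Plane, z ∈ Metric.closedBall (0 : Plane) n →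
      phase θ t₂ z * v t₂ z - phase θ t₁ z * v t₁ z = ∫ t in t₁..t₂, phase θ t z * N t z by
    filter_upwards [ae_all_iff.2 H] with z hz
    obtain ⟨n, hn⟩ := exists_nat_ge ‖z‖
    exact hz n (by simpa using hn)
  intro n
  set B := Metric.closedBall (0 : Plane) n with hB
  have hBm : MeasurableSet B := Metric.isClosed_closedBall.measurableSet
  have hBf : volume B ≠ ∞ := measure_closedBall_lt_top.ne
  obtain ⟨C, hC⟩ := hθb n
  obtain ⟨K, hK⟩ := ((isCompact_Icc (a := t₁) (b := t₂)).prod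
    (isCompact_closedBall (0 : Plane) n)).exists_bound_of_continuousOn hN.continuousOn
  have : IsFiniteMeasure ((volume : Measure Plane).restrict B) := ⟨by
    rw [Measure.restrict_apply_univ]; exact hBf.lt_top⟩
  have : IsFiniteMeasure ((volume : Measure ℝ).restrict (uIoc t₁ t₂)) := by
    rw [uIoc_of_le h₁₂]; infer_instance
  have hint : Integrable (Function.uncurry fun t z => phase θ t z * N t z)
      ((volume.restrict (uIoc t₁ t₂)).prod (volume.restrict B)) := by
    refine Integrable.mono' (g := fun _ => K) (integrable_const K) ?_ ?_
    · exact ((measurable_phase hθ).aestronglyMeasurable).mul hN.aestronglyMeasurable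
    · rw [Measure.prod_restrict]
      filter_upwards [ae_restrict_mem (measurableSet_uIoc.prod hBm)] with q hq
      rw [Function.uncurry, norm_mul, norm_phase, one_mul]
      rw [uIoc_of_le h₁₂] at hq
      exact hK q ⟨Ioc_subset_Icc_self hq.1, hq.2⟩
  have hphint : ∀ t, Integrable (fun z => phase θ t z * v t z) (volume.restrict B) := by
    intro t
    have i0 : Integrable (v t : Plane → ℂ) (volume.restrict B) :=
      ((Lp.memLp (v t)).mono_measure Measure.restrict_le_self).integrable (by norm_num)
    refine i0.bdd_mul (c := 1) ?_ ?_
    · exact ((measurable_phase hθ).comp measurable_prodMk_left).aestronglyMeasurable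
    · exact Eventually.of_forall fun z => (norm_phase θ t z).le
  have key := Integrable.ae_eq_of_forall_setIntegral_eq
    (μ := volume.restrict B)
    (fun z => phase θ t₂ z * v t₂ z - phase θ t₁ z * v t₁ z)
    (fun z => ∫ t in t₁..t₂, phase θ t z * N t z)
    ((hphint t₂).sub (hphint t₁)) ?_ ?_
  · exact (ae_restrict_iff' hBm).1 key
  · have := hint.integral_prod_right
    simp only [intervalIntegral.integral_of_le h₁₂]
    rw [uIoc_of_le h₁₂] at this
    exact this
  intro S hS _
  rw [Measure.restrict_restrict hS]
  set A := S ∩ B with hAdef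
  have hA : MeasurableSet A := hS.inter hBm
  have hAB : A ⊆ B := inter_subset_right
  have hAf : volume A ≠ ∞ := ((measure_mono hAB).trans_lt hBf.lt_top).ne
  have hCA : ∀ z ∈ A, |θ z| ≤ C := fun z hz => hC z (by simpa [hB] using hAB hz)
  have hm : ∀ t, Measurable (phase θ t) := fun t => (measurable_phase hθ).comp measurable_prodMk_left
  have hE : ∀ t, MemLp (A.indicator (phase θ t)) 2 (volume : Measure Plane) := fun t =>
    memLp_indicator_of_bound hA hAf (hm t) (C := 1) fun z _ => (norm_phase θ t z).le
  have hE' : ∀ t, MemLp (A.indicator (fun z => -(Complex.I * θ z) * phase θ t z)) 2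
      (volume : Measure Plane) := fun t =>
    memLp_indicator_of_bound hA hAf
      (((Complex.measurable_ofReal.comp hθ).const_mul Complex.I).neg.mul (hm t)) (C := C)
      fun z hz => by
        rw [norm_mul, norm_phase, mul_one, norm_neg, norm_mul, Complex.norm_I, one_mul,
          Complex.norm_real]
        exact hCA z hz
  have hpair : ∀ t (f : L2Plane), pairing2 (hE t).toLp f = ∫ z in A, phase θ t z * f z := by
    intro t f
    rw [pairing2_apply, ← integral_indicator hA]
    apply integral_congr_ae
    filter_upwards [(hE t).coeFn_toLp] with z hz
    rw [hz]
    by_cases h : z ∈ A <;> simp [h]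
  -- The derivative `-i θ` of the integrating factor cancels the term `i θ v` of `v'`; only `N`
  -- survives.
  have hF : ∀ t ∈ Icc 0 T, HasDerivWithinAt (fun t => pairing2 (hE t).toLp (v t))
      (∫ z in A, phase θ t z * N t z) (Icc 0 T) t := by
    intro t ht
    obtain ⟨v', hv', hv'e⟩ := hv t ht
    have := (pairing2.bilinearRestrictScalars ℝ).hasDerivWithinAt_of_bilinear
      (hasDerivAt_phase_toLp hA hAf hCA hE hE' t).hasDerivWithinAt hv'
    simp only [ContinuousLinearMap.bilinearRestrictScalars_apply_apply] at this
    refine this.congr_deriv ?_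
    symm
    rw [pairing2_apply, pairing2_apply, ← integral_add (integrable_coe_mul _ _)
      (integrable_coe_mul _ _), ← integral_indicator hA]
    apply integral_congr_ae
    filter_upwards [(hE t).coeFn_toLp, (hE' t).coeFn_toLp, hv'e] with z e1 e2 e3
    rw [e1, e2, e3]
    by_cases h : z ∈ A
    · simp only [indicator_of_mem h]; ring
    · simp [h]
  have hintA : Integrable (Function.uncurry fun t z => phase θ t z * N t z)
      ((volume.restrict (uIoc t₁ t₂)).prod (volume.restrict A)) :=
    by
    refine hint.mono_measure ?_
    rw [Measure.prod_restrict, Measure.prod_restrict]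
    exact Measure.restrict_mono (prod_mono le_rfl hAB) le_rfl
  have hsub : Icc t₁ t₂ ⊆ Icc 0 T := Icc_subset_Icc h₁.1 h₂.2
  have ftc := intervalIntegral.integral_eq_sub_of_hasDeriv_right_of_le h₁₂
    (f := fun t => pairing2 (hE t).toLp (v t)) (f' := fun t => ∫ z in A, phase θ t z * N t z)
    (fun t ht => ((hF t (hsub ht)).mono hsub).continuousWithinAt)
    (fun t ht => (hF t (hsub (Ioo_subset_Icc_self ht))).mono_of_mem_nhdsWithin
      (mem_nhdsWithin_of_mem_nhds (Icc_mem_nhds (h₁.1.trans_lt ht.1) (ht.2.trans_le h₂.2))))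
    (by
      rw [intervalIntegrable_iff]
      exact hintA.integral_prod_left)
  rw [intervalIntegral_integral_swap hintA] at ftc
  rw [ftc, hpair, hpair, integral_sub]
  · exact (hphint t₂).mono_measure (Measure.restrict_mono hAB le_rfl)
  · exact (hphint t₁).mono_measure (Measure.restrict_mono hAB le_rfl)

end Duhamel

/-! ### Identification of the plane with `ℝ × ℝ` -/

section Coordinates

/-- The coordinates of the plane, as a measurable equivalence. -/
def planeEquiv : Plane ≃ᵐ ℝ × ℝ :=
  (MeasurableEquiv.toLp 2 (Fin 2 → ℝ)).symm.trans MeasurableEquiv.finTwoArrow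

theorem measurePreserving_planeEquiv : MeasurePreserving planeEquiv volume volume :=
  (volume_preserving_finTwoArrow ℝ).comp
    (EuclideanSpace.volume_preserving_symm_measurableEquiv_toLp (Fin 2))

theorem integrable_plane_iff {E : Type*} [NormedAddCommGroup E] {f : Plane → E} :
    Integrable (fun q : ℝ × ℝ => f !₂[q.1, q.2]) (volume.prod volume) ↔ Integrable f :=
  (measurePreserving_planeEquiv.symm planeEquiv).integrable_comp_emb
    planeEquiv.symm.measurableEmbedding

theorem integral_plane {E : Type*} [NormedAddCommGroup E] [NormedSpace ℝ E] (f : Plane → E) :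
    ∫ p, f p = ∫ q : ℝ × ℝ, f !₂[q.1, q.2] ∂(volume.prod volume) :=
  ((measurePreserving_planeEquiv.symm planeEquiv).integral_comp
    planeEquiv.symm.measurableEmbedding f).symm

theorem ae_plane_iff {P : Plane → Prop} :
    (∀ᵐ q : ℝ × ℝ ∂(volume.prod volume), P !₂[q.1, q.2]) ↔ ∀ᵐ p, P p := by
  have h := (measurePreserving_planeEquiv.symm planeEquiv).map_eq
  rw [← h]
  exact (planeEquiv.symm.measurableEmbedding.ae_map_iff).symm

theorem continuous_plane : Continuous (fun q : ℝ × ℝ => (!₂[q.1, q.2] : Plane)) := by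
  refine (PiLp.continuous_toLp 2 _).comp (continuous_pi fun i => ?_)
  fin_cases i
  · exact continuous_fst
  · exact continuous_snd

end Coordinates

/-! ### Integrability from the weighted norm -/

section Weights

theorem one_add_rpow_le {x α : ℝ} (hx : 0 ≤ x) (hα : 0 ≤ α) :
    (1 + x) ^ α ≤ 2 ^ α * (1 + x ^ α) := by
  have h0 : 0 ≤ x ^ α := Real.rpow_nonneg hx α
  have h2 : (0 : ℝ) ≤ 2 ^ α := by positivity
  rcases le_total x 1 with h | h
  · calc (1 + x) ^ α ≤ 2 ^ α := Real.rpow_le_rpow (by linarith) (by linarith) hα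
      _ ≤ _ := by nlinarith
  · calc (1 + x) ^ α ≤ (2 * x) ^ α := Real.rpow_le_rpow (by linarith) (by linarith) hα
      _ = 2 ^ α * x ^ α := Real.mul_rpow (by norm_num) hx
      _ ≤ _ := by nlinarith

theorem integrable_pow_div_one_add_rpow {α : ℝ} (k : ℕ) (h : 2 * (k : ℝ) + 1 < α) :
    Integrable (fun x : ℝ => |x| ^ (2 * k) / (1 + |x| ^ α)) := by
  have hk : (0 : ℝ) ≤ k := Nat.cast_nonneg k
  have hα : 0 < α := by linarith
  have i := (integrable_one_add_norm (E := ℝ) (μ := volume) (r := α - 2 * k)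
    (by simp; linarith)).const_mul (2 ^ α)
  refine i.mono' ?_ (Eventually.of_forall fun x => ?_)
  · apply Measurable.aestronglyMeasurable; fun_prop
  have hx := abs_nonneg x
  have h0 : 0 ≤ |x| ^ α := Real.rpow_nonneg hx α
  rw [Real.norm_of_nonneg (by positivity), Real.norm_eq_abs, div_le_iff₀ (by positivity),
    show -(α - 2 * k) = ((2 * k : ℕ) : ℝ) - α by push_cast; ring,
    Real.rpow_sub (by positivity), Real.rpow_natCast]
  have h1 : |x| ^ (2 * k) ≤ (1 + |x|) ^ (2 * k) := by gcongr; linarith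
  have h2 := one_add_rpow_le hx hα.le
  have h3 : (0 : ℝ) < (1 + |x|) ^ α := by positivity
  calc |x| ^ (2 * k) ≤ (1 + |x|) ^ (2 * k) * 1 := by rw [mul_one]; exact h1
    _ ≤ (1 + |x|) ^ (2 * k) * ((2 ^ α * (1 + |x| ^ α)) / (1 + |x|) ^ α) := by
        gcongr; rwa [le_div_iff₀ h3, one_mul]
    _ = _ := by ring

theorem one_add_rpow_mul_one_add_rpow_le {X Y θ : ℝ} (hX : 0 ≤ X) (hY : 0 ≤ Y) (h0 : 0 ≤ θ)
    (h1 : θ ≤ 1) : (1 + X ^ θ) * (1 + Y ^ (1 - θ)) ≤ 3 * (1 + X + Y) := by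
  have a := Real.geom_mean_le_arith_mean2_weighted h0 (sub_nonneg.2 h1) hX hY (by ring)
  have b := Real.geom_mean_le_arith_mean2_weighted h0 (sub_nonneg.2 h1) hX zero_le_one (by ring)
  have c := Real.geom_mean_le_arith_mean2_weighted h0 (sub_nonneg.2 h1) zero_le_one hY (by ring)
  rw [Real.one_rpow] at b c
  nlinarith [mul_nonneg h0 hX, mul_nonneg h0 hY, mul_nonneg (sub_nonneg.2 h1) hX,
    mul_nonneg (sub_nonneg.2 h1) hY]

/-- The anisotropic weight dominates, by weighted AM-GM, a product of one-variable weights with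
exponents `2aθ` and `2b(1 - θ)`. The parameter `θ` distributes the decay between `x` and `y`. -/
theorem integrable_pow_div_weight {a b θ : ℝ} (k : ℕ) (h0 : 0 ≤ θ)
    (h1 : θ ≤ 1) (hx : 2 * (k : ℝ) + 1 < 2 * a * θ) (hy : 1 < 2 * b * (1 - θ)) :
    Integrable (fun p : Plane => |p 0| ^ (2 * k) / (1 + (|p 0| ^ (2 * a) + |p 1| ^ (2 * b)))) := by
  rw [← integrable_plane_iff]
  have i1 := integrable_pow_div_one_add_rpow k hx
  have i2 := integrable_pow_div_one_add_rpow (α := 2 * b * (1 - θ)) 0 (by simpa using hy)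
  refine ((i1.mul_prod i2).const_mul 3).mono' ?_ (Eventually.of_forall fun q => ?_)
  · apply Measurable.aestronglyMeasurable
    simp only [Matrix.cons_val_zero, Matrix.cons_val_one]
    fun_prop
  obtain ⟨x, y⟩ := q
  simp only [Matrix.cons_val_zero, Matrix.cons_val_one, mul_zero, pow_zero]
  have hX : 0 ≤ |x| ^ (2 * a) := Real.rpow_nonneg (abs_nonneg x) _
  have hY : 0 ≤ |y| ^ (2 * b) := Real.rpow_nonneg (abs_nonneg y) _
  have hX' : 0 ≤ |x| ^ (2 * a * θ) := Real.rpow_nonneg (abs_nonneg x) _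
  have hY' : 0 ≤ |y| ^ (2 * b * (1 - θ)) := Real.rpow_nonneg (abs_nonneg y) _
  have key := one_add_rpow_mul_one_add_rpow_le hX hY h0 h1
  rw [← Real.rpow_mul (abs_nonneg x), ← Real.rpow_mul (abs_nonneg y)] at key
  rw [Real.norm_of_nonneg (by positivity), div_mul_div_comm, mul_one, ← mul_div_assoc,
    div_le_div_iff₀ (by positivity) (by positivity)]
  have hp : 0 ≤ |x| ^ (2 * k) := by positivity
  nlinarith [mul_le_mul_of_nonneg_left key hp]

theorem integrable_weight_of_weightedENorm {a b : ℝ} {f : L2Plane}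
    (h : weightedENorm a b f < ∞) :
    Integrable (fun p : Plane => (|p 0| ^ (2 * a) + |p 1| ^ (2 * b)) * ‖f p‖ ^ 2) := by
  set w : Plane → ℝ := fun p => |p 0| ^ (2 * a) + |p 1| ^ (2 * b) with hw
  have hw0 : ∀ p, 0 ≤ w p := fun p =>
    add_nonneg (Real.rpow_nonneg (abs_nonneg _) _) (Real.rpow_nonneg (abs_nonneg _) _)
  have hwm : Measurable w := by fun_prop
  have hm : AEStronglyMeasurable (f : Plane → ℂ)
      ((volume : Measure Plane).withDensity fun p => ENNReal.ofReal (w p)) :=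
    (Lp.aestronglyMeasurable f).mono_ac (withDensity_absolutelyContinuous _ _)
  have hL : MemLp (f : Plane → ℂ) 2
      ((volume : Measure Plane).withDensity fun p => ENNReal.ofReal (w p)) := ⟨hm, h⟩
  have hI := (memLp_two_iff_integrable_sq_norm hm).1 hL
  rw [integrable_withDensity_iff (by fun_prop) (by simp)] at hI
  refine hI.congr (Eventually.of_forall fun p => ?_)
  simp only [ENNReal.toReal_ofReal (hw0 p)]
  ring

theorem integrable_norm_sq (f : L2Plane) : Integrable (fun p : Plane => ‖f p‖ ^ 2) :=
  (memLp_two_iff_integrable_sq_norm (Lp.aestronglyMeasurable f)).1 (Lp.memLp f)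

/-- With `W` the weight plus one, `|x|^k |f| ≤ |x|^{2k} / W + W |f|²`, and both terms are
integrable. -/
theorem integrable_pow_mul_of_weightedENorm {a b θ : ℝ} (k : ℕ) (h0 : 0 ≤ θ)
    (h1 : θ ≤ 1) (hx : 2 * (k : ℝ) + 1 < 2 * a * θ) (hy : 1 < 2 * b * (1 - θ)) {f : L2Plane}
    (h : weightedENorm a b f < ∞) :
    Integrable (fun p : Plane => ((p 0 : ℝ) : ℂ) ^ k * f p) := by
  refine ((integrable_pow_div_weight k h0 h1 hx hy).add
    ((integrable_norm_sq f).add (integrable_weight_of_weightedENorm h))).mono' ?_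
    (Eventually.of_forall fun p => ?_)
  · refine AEStronglyMeasurable.mul ?_ (Lp.aestronglyMeasurable f)
    apply Continuous.aestronglyMeasurable; fun_prop
  simp only [Pi.add_apply, norm_mul, norm_pow, Complex.norm_real, Real.norm_eq_abs]
  have hX : 0 ≤ |p 0| ^ (2 * a) := Real.rpow_nonneg (abs_nonneg _) _
  have hY : 0 ≤ |p 1| ^ (2 * b) := Real.rpow_nonneg (abs_nonneg _) _
  set W := 1 + (|p 0| ^ (2 * a) + |p 1| ^ (2 * b)) with hW
  have hWp : 0 < W := by positivity
  have e : ‖f p‖ ^ 2 + (|p 0| ^ (2 * a) + |p 1| ^ (2 * b)) * ‖f p‖ ^ 2 = W * ‖f p‖ ^ 2 := by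
    rw [hW]; ring
  rw [e, pow_mul', div_add' _ _ _ hWp.ne', le_div_iff₀ hWp]
  nlinarith [sq_nonneg (|p 0| ^ k - W * ‖f p‖), mul_nonneg (pow_nonneg (abs_nonneg (p 0)) k)
    (mul_nonneg hWp.le (norm_nonneg (f p)))]

end Weights

/-! ### Partial Fourier transform in `y` -/

section PartialFourier

theorem plancherel_real {h : ℝ → ℂ} (h1 : Integrable h) (h2 : Integrable fun y => ‖h y‖ ^ 2) :
    Integrable (fun η => ‖𝓕 h η‖ ^ 2) ∧ ∫ η, ‖𝓕 h η‖ ^ 2 = ∫ y, ‖h y‖ ^ 2 := by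
  have m2 : MemLp h 2 := (memLp_two_iff_integrable_sq_norm h1.1).2 h2
  have hc := continuous_fourier_of_integrable h1
  have e := eLpNorm_fourier_eq h1 m2
  have M2 : MemLp (𝓕 h) 2 := ⟨hc.aestronglyMeasurable, e ▸ m2.2⟩
  refine ⟨(memLp_two_iff_integrable_sq_norm M2.1).1 M2, ?_⟩
  have key : ∀ {k : ℝ → ℂ}, AEStronglyMeasurable k volume →
      ∫ y, ‖k y‖ ^ 2 = ((eLpNorm k 2 volume) ^ 2).toReal := by
    intro k hk
    rw [integral_eq_lintegral_of_nonneg_ae (Eventually.of_forall fun y => sq_nonneg _)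
      (hk.norm.pow 2)]
    have := eLpNorm_nnreal_pow_eq_lintegral (f := k) (μ := volume) (p := 2) (by norm_num)
    simp only [NNReal.coe_ofNat, ENNReal.coe_ofNat, ENNReal.rpow_ofNat] at this
    rw [this]
    congr 1
    apply lintegral_congr
    intro y
    rw [← ofReal_norm, ENNReal.ofReal_pow (norm_nonneg _)]
  rw [key M2.1, key m2.1, e]

/-- The partial Fourier transform in the second variable of a function in `L¹ ∩ L²`. -/
theorem exists_partialFourier {F : ℝ × ℝ → ℂ} (hF : Integrable F (volume.prod volume))
    (hF2 : Integrable (fun q => ‖F q‖ ^ 2) (volume.prod volume)) :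
    ∃ g : ℝ → ℝ → ℂ, (∀ η, Integrable fun x => g x η) ∧
      (∀ ξ η, 𝓕 (fun x => g x η) ξ = ∫ q : ℝ × ℝ,
        Complex.exp (((-2 * Real.pi * (q.1 * ξ + q.2 * η) : ℝ) : ℂ) * Complex.I) * F q
          ∂(volume.prod volume)) ∧
      ∀ w : ℝ → ℝ, Measurable w → (∀ x, 0 ≤ w x) →
        Integrable (fun q : ℝ × ℝ => w q.1 * ‖F q‖ ^ 2) (volume.prod volume) →
        ∀ᵐ η, Integrable fun x => w x * ‖g x η‖ ^ 2 := by
  -- A strongly measurable representative makes the slicewise transform jointly measurable in `(x,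
  -- η)`.
  set F' := hF.1.mk F with hF'
  have hm : StronglyMeasurable F' := hF.1.stronglyMeasurable_mk
  have hae : F =ᵐ[volume.prod volume] F' := hF.1.ae_eq_mk
  have i1 : Integrable F' (volume.prod volume) := hF.congr hae
  have i2 : Integrable (fun q => ‖F' q‖ ^ 2) (volume.prod volume) :=
    hF2.congr (hae.mono fun q hq => by simp only [hq])
  have iexp : ∀ η : ℝ, Integrable (fun q : ℝ × ℝ =>
      Complex.exp (((-2 * Real.pi * q.2 * η : ℝ) : ℂ) * Complex.I) • F' q)
      (volume.prod volume) := by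
    intro η
    refine i1.bdd_mul (c := 1) ?_ (Eventually.of_forall fun q => ?_)
    · apply Continuous.aestronglyMeasurable; fun_prop
    · exact (Complex.norm_exp_ofReal_mul_I _).le
  have gdef : ∀ x η, 𝓕 (fun y => F' (x, y)) η =
      ∫ y, Complex.exp (((-2 * Real.pi * y * η : ℝ) : ℂ) * Complex.I) • F' (x, y) :=
    fun x η => Real.fourier_real_eq_integral_exp_smul _ _
  refine ⟨fun x η => 𝓕 (fun y => F' (x, y)) η, fun η => ?_, fun ξ η => ?_, fun w hw hw0 hwi => ?_⟩
  · simp only [gdef]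
    exact (iexp η).integral_prod_left
  · rw [Real.fourier_real_eq_integral_exp_smul]
    have e1 : ∫ q : ℝ × ℝ,
        Complex.exp (((-2 * Real.pi * (q.1 * ξ + q.2 * η) : ℝ) : ℂ) * Complex.I) * F q
          ∂(volume.prod volume) = ∫ q : ℝ × ℝ,
        Complex.exp (((-2 * Real.pi * q.1 * ξ : ℝ) : ℂ) * Complex.I) *
          (Complex.exp (((-2 * Real.pi * q.2 * η : ℝ) : ℂ) * Complex.I) • F' q)
          ∂(volume.prod volume) := by
      apply integral_congr_ae
      filter_upwards [hae] with q hq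
      rw [hq, smul_eq_mul, ← mul_assoc, ← Complex.exp_add]
      congr 2
      push_cast; ring
    rw [e1, integral_prod]
    · congr 1; ext x
      simp only [gdef]
      rw [integral_const_mul, smul_eq_mul]
    · refine (iexp η).bdd_mul (c := 1) ?_ (Eventually.of_forall fun q => ?_)
      · apply Continuous.aestronglyMeasurable; fun_prop
      · exact (Complex.norm_exp_ofReal_mul_I _).le
  · have hwi' : Integrable (fun q : ℝ × ℝ => w q.1 * ‖F' q‖ ^ 2) (volume.prod volume) :=
      hwi.congr (hae.mono fun q hq => by simp only [hq])
    have gm : StronglyMeasurable (fun q : ℝ × ℝ => 𝓕 (fun y => F' (q.1, y)) q.2) := by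
      simp only [gdef]
      refine StronglyMeasurable.integral_prod_right' (f := fun r : (ℝ × ℝ) × ℝ =>
        Complex.exp (((-2 * Real.pi * r.2 * r.1.2 : ℝ) : ℂ) * Complex.I) • F' (r.1.1, r.2)) ?_
      refine StronglyMeasurable.mul ?_ ?_
      · apply Continuous.stronglyMeasurable; fun_prop
      · exact hm.comp_measurable (by fun_prop)
    have key : Integrable (fun q : ℝ × ℝ => w q.1 * ‖𝓕 (fun y => F' (q.1, y)) q.2‖ ^ 2)
        (volume.prod volume) := by
      -- Plancherel in `y` on almost every line; a weight depending on `x` alone passes through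
      -- unchanged.
      have hp : ∀ᵐ x : ℝ, Integrable (fun η => ‖𝓕 (fun y => F' (x, y)) η‖ ^ 2) ∧
          ∫ η, ‖𝓕 (fun y => F' (x, y)) η‖ ^ 2 = ∫ y, ‖F' (x, y)‖ ^ 2 := by
        filter_upwards [i1.prod_right_ae, i2.prod_right_ae] with x hx1 hx2
        exact plancherel_real hx1 hx2
      rw [integrable_prod_iff]
      · refine ⟨hp.mono fun x hx => hx.1.const_mul (w x), ?_⟩
        refine hwi'.integral_prod_left.congr (hp.mono fun x hx => ?_)
        simp only [norm_mul, norm_pow, norm_norm, Real.norm_of_nonneg (hw0 x)]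
        rw [integral_const_mul, integral_const_mul, hx.2]
      · exact ((hw.comp measurable_fst).aestronglyMeasurable).mul
          ((gm.norm.pow 2).aestronglyMeasurable)
    exact key.prod_left_ae

end PartialFourier

/-! ### Regularity in `ξ` from weights in `x` -/

section OneDimensional

/-- Since `2r > 3`, `x² / (1 + |x|^{2r})` is integrable, so `x g` is integrable. This fails at the
critical `r = 3/2`. -/
theorem contDiff_fourier_of_weight {g : ℝ → ℂ} (hg : Integrable g) {r : ℝ} (hr : 3 / 2 < r)
    (h0 : Integrable fun x => ‖g x‖ ^ 2) (h : Integrable fun x => |x| ^ (2 * r) * ‖g x‖ ^ 2) :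
    ContDiff ℝ 1 (𝓕 g) := by
  have hx : Integrable (fun x => |x| * ‖g x‖) := by
    refine ((integrable_pow_div_one_add_rpow (α := 2 * r) 1 (by push_cast; linarith)).add
      (h0.add h)).mono' (by
        refine AEStronglyMeasurable.mul ?_ hg.1.norm
        exact continuous_abs.aestronglyMeasurable) (Eventually.of_forall fun x => ?_)
    have hX : 0 ≤ |x| ^ (2 * r) := Real.rpow_nonneg (abs_nonneg x) _
    have hW : 0 < 1 + |x| ^ (2 * r) := by positivity
    rw [Real.norm_of_nonneg (by positivity)]
    simp only [Pi.add_apply, mul_one]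
    rw [div_add' _ _ _ hW.ne', le_div_iff₀ hW]
    nlinarith [sq_nonneg (|x| - (1 + |x| ^ (2 * r)) * ‖g x‖),
      mul_nonneg (abs_nonneg x) (mul_nonneg hW.le (norm_nonneg (g x)))]
  have := Real.contDiff_fourier (f := g) (N := 1) (fun n hn => ?_)
  · exact_mod_cast this
  have hn' : n ≤ 1 := by exact_mod_cast hn
  interval_cases n
  · simpa using hg.norm
  · simpa [Real.norm_eq_abs] using hx

/-- The left side vanishes to fourth order at `0` and grows quadratically, so a cube controls it.
The factor `1 + t²` is kept because its reciprocal is integrable: it supplies the majorant `P` of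
the next estimate. -/
theorem two_sub_cos_sq_le (t : ℝ) :
    (2 - 2 * Real.cos t) ^ 2 * (1 + t ^ 2) ≤ 32 * |t| ^ 3 := by
  have h0 : 0 ≤ 2 - 2 * Real.cos t := by linarith [Real.cos_le_one t]
  have h1 : 2 - 2 * Real.cos t ≤ |t| ^ 2 := by
    rw [sq_abs]; linarith [Real.one_sub_sq_div_two_le_cos (x := t)]
  have h2 : 2 - 2 * Real.cos t ≤ 4 := by linarith [Real.neg_one_le_cos t]
  rw [← sq_abs t]
  have ht := abs_nonneg t
  set a := |t|
  set m := 2 - 2 * Real.cos t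
  rcases le_total a 1 with ha | ha
  · have s1 : m ^ 2 ≤ (a ^ 2) ^ 2 := by gcongr
    have s2 : (1 + a ^ 2) ≤ 2 := by nlinarith
    calc m ^ 2 * (1 + a ^ 2) ≤ (a ^ 2) ^ 2 * 2 := by gcongr
      _ = 2 * (a ^ 3 * a) := by ring
      _ ≤ 2 * (a ^ 3 * 1) := by gcongr
      _ ≤ _ := by nlinarith [pow_nonneg ht 3]
  · have s1 : m ^ 2 ≤ 4 ^ 2 := by gcongr
    have s2 : (1 + a ^ 2) ≤ 2 * a ^ 2 := by nlinarith
    calc m ^ 2 * (1 + a ^ 2) ≤ 4 ^ 2 * (2 * a ^ 2) := by gcongr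
      _ = 32 * (a ^ 2 * 1) := by ring
      _ ≤ 32 * (a ^ 2 * a) := by gcongr
      _ = _ := by ring

theorem fourier_second_difference {g : ℝ → ℂ} (hg : Integrable g) (ξ : ℝ) :
    ‖𝓕 g ξ + 𝓕 g (-ξ) - 2 * 𝓕 g 0‖ ≤
      ∫ x, (2 - 2 * Real.cos (2 * Real.pi * ξ * x)) * ‖g x‖ := by
  have hi : ∀ w : ℝ, Integrable (fun x : ℝ =>
      Complex.exp (((-2 * Real.pi * x * w : ℝ) : ℂ) * Complex.I) • g x) := by
    intro w
    refine hg.bdd_mul (c := 1) ?_ (Eventually.of_forall fun q => ?_)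
    · apply Continuous.aestronglyMeasurable; fun_prop
    · exact (Complex.norm_exp_ofReal_mul_I _).le
  simp only [Real.fourier_real_eq_integral_exp_smul]
  have hs : Integrable (fun x : ℝ =>
      Complex.exp (((-2 * Real.pi * x * ξ : ℝ) : ℂ) * Complex.I) • g x +
      Complex.exp (((-2 * Real.pi * x * -ξ : ℝ) : ℂ) * Complex.I) • g x) :=
    (hi ξ).add (hi (-ξ))
  rw [← integral_const_mul, ← integral_add (hi ξ) (hi (-ξ)), ← integral_sub
    hs ((hi 0).const_mul 2)]
  refine (norm_integral_le_integral_norm _).trans (le_of_eq ?_)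
  congr 1; ext x
  have e : Complex.exp (((-2 * Real.pi * x * ξ : ℝ) : ℂ) * Complex.I) • g x +
      Complex.exp (((-2 * Real.pi * x * -ξ : ℝ) : ℂ) * Complex.I) • g x -
      2 * Complex.exp (((-2 * Real.pi * x * 0 : ℝ) : ℂ) * Complex.I) • g x =
      ((-(2 - 2 * Real.cos (2 * Real.pi * ξ * x)) : ℝ) : ℂ) * g x := by
    have : (2 : ℂ) * Complex.cos ((2 * Real.pi * ξ * x : ℝ) : ℂ) =
        Complex.exp (((-2 * Real.pi * x * ξ : ℝ) : ℂ) * Complex.I) +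
        Complex.exp (((-2 * Real.pi * x * -ξ : ℝ) : ℂ) * Complex.I) := by
      rw [Complex.two_cos, add_comm]
      congr 2 <;> (push_cast; ring)
    push_cast at this ⊢
    rw [neg_sub, this]
    simp
    ring
  rw [e, norm_mul, Complex.norm_real, Real.norm_eq_abs, abs_neg, abs_of_nonneg]
  linarith [Real.cos_le_one (2 * Real.pi * ξ * x)]

/-- A function whose Fourier transform lies in `L²(|x|³ dx)` has no corners. -/
theorem fourier_second_difference_isLittleO {g : ℝ → ℂ} (hg : Integrable g)
    (h : Integrable fun x => |x| ^ 3 * ‖g x‖ ^ 2) :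
    (fun ξ : ℝ => 𝓕 g ξ + 𝓕 g (-ξ) - 2 * 𝓕 g 0) =o[𝓝 0] fun ξ => ξ := by
  set m : ℝ → ℝ → ℝ := fun τ x => 2 - 2 * Real.cos (τ * x) with hm
  have hm0 : ∀ τ x, 0 ≤ m τ x := fun τ x => by
    simp only [hm]; linarith [Real.cos_le_one (τ * x)]
  have hmt : ∀ τ x, m τ x ≤ |τ| ^ 2 * |x| ^ 2 := fun τ x => by
    have := Real.one_sub_sq_div_two_le_cos (x := τ * x)
    simp only [hm, sq_abs]; nlinarith
  -- the main estimate, at the natural scale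
  have main : Tendsto (fun τ : ℝ => ∫ x, m τ x / |τ| * ‖g x‖) (𝓝[≠] 0) (𝓝 0) := by
    rw [Metric.tendsto_nhds]
    intro ε hε
    -- Chosen so that `lam` times the mass `32 π` of `P τ` is `ε / 2`.
    set lam : ℝ := ε / (64 * Real.pi) with hlam
    have hlam0 : 0 < lam := by positivity
    -- `P τ` has the same integral for all `τ ≠ 0`, and `(m τ x / |τ|)² ≤ P τ x · |x|³`.
    set P : ℝ → ℝ → ℝ := fun τ x => 32 * |τ| * (1 + (τ * x) ^ 2)⁻¹ with hP
    have hPi : ∀ τ : ℝ, τ ≠ 0 → Integrable (P τ) ∧ ∫ x, P τ x = 32 * Real.pi := by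
      intro τ hτ
      refine ⟨(integrable_inv_one_add_sq.comp_mul_left' hτ).const_mul _, ?_⟩
      simp only [hP]
      rw [integral_const_mul, Measure.integral_comp_mul_left (fun x => (1 + x ^ 2)⁻¹) τ,
        integral_univ_inv_one_add_sq, smul_eq_mul, abs_inv]
      have : |τ| ≠ 0 := abs_ne_zero.2 hτ
      field_simp
    -- The integrand is at most `lam * P + H`. The first part has small mass; the excess `H` has a
    -- dominating function independent of `τ`, whereas the integrand itself need not.
    set H : ℝ → ℝ → ℝ := fun τ x => max 0 (m τ x / |τ| * ‖g x‖ - lam * P τ x) with hH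
    have hmm : ∀ τ, Measurable (m τ) := fun τ => by simp only [hm]; fun_prop
    have hPm : ∀ τ, Measurable (P τ) := fun τ => by simp only [hP]; fun_prop
    have hHm : ∀ τ, AEStronglyMeasurable (H τ) := fun τ => by
      refine AEStronglyMeasurable.sup aestronglyMeasurable_const (AEStronglyMeasurable.sub
        (AEStronglyMeasurable.mul ?_ hg.1.norm) ?_)
      · exact ((hmm τ).div_const _).aestronglyMeasurable
      · exact ((hPm τ).const_mul _).aestronglyMeasurable
    have hHb : ∀ τ : ℝ, τ ≠ 0 → ∀ x, ‖H τ x‖ ≤ lam⁻¹ * (|x| ^ 3 * ‖g x‖ ^ 2) := by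
      intro τ hτ x
      have hτ' : 0 < |τ| := abs_pos.2 hτ
      rw [Real.norm_of_nonneg (le_max_left _ _)]
      refine max_le (by positivity) ?_
      set a := m τ x / |τ| with ha
      have ha0 : 0 ≤ a := div_nonneg (hm0 τ x) hτ'.le
      have hP0 : 0 < P τ x := by simp only [hP]; positivity
      have h1 : a ^ 2 ≤ P τ x * |x| ^ 3 := by
        have := two_sub_cos_sq_le (τ * x)
        rw [abs_mul, mul_pow |τ|] at this
        rw [ha, div_pow, div_le_iff₀ (by positivity)]
        have e : P τ x * |x| ^ 3 * |τ| ^ 2 = 32 * (|τ| ^ 3 * |x| ^ 3) / (1 + (τ * x) ^ 2) := by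
          simp only [hP]; field_simp
        rw [e, le_div_iff₀ (by positivity)]
        exact this
      rw [inv_mul_eq_div, le_div_iff₀ hlam0]
      have h2 : (a * ‖g x‖) ^ 2 ≤ P τ x * (|x| ^ 3 * ‖g x‖ ^ 2) := by
        rw [mul_pow, ← mul_assoc]; gcongr
      set b := a * ‖g x‖
      set c := |x| ^ 3 * ‖g x‖ ^ 2
      by_contra hcon
      push Not at hcon
      -- AM-GM: `b² ≤ P c` gives `b ≤ lam P + c / (4 lam)`.
      nlinarith [sq_nonneg (b - 2 * lam * P τ x), mul_pos hlam0 hP0]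
    have hHt : Tendsto (fun τ => ∫ x, H τ x) (𝓝[≠] 0) (𝓝 (∫ _ : ℝ, (0 : ℝ))) := by
      refine tendsto_integral_filter_of_dominated_convergence
        (fun x => lam⁻¹ * (|x| ^ 3 * ‖g x‖ ^ 2)) (Eventually.of_forall hHm) ?_
        (h.const_mul _) (Eventually.of_forall fun x => ?_)
      · filter_upwards [self_mem_nhdsWithin] with τ hτ
        exact Eventually.of_forall (hHb τ hτ)
      · have hz : Tendsto (fun τ : ℝ => |τ| * |x| ^ 2 * ‖g x‖) (𝓝[≠] 0) (𝓝 0) := by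
          have : Continuous (fun τ : ℝ => |τ| * |x| ^ 2 * ‖g x‖) := by fun_prop
          simpa using (this.tendsto 0).mono_left nhdsWithin_le_nhds
        refine squeeze_zero' (Eventually.of_forall fun τ => le_max_left _ _) ?_ hz
        filter_upwards [self_mem_nhdsWithin] with τ hτ
        have hτ' : 0 < |τ| := abs_pos.2 hτ
        refine max_le (by positivity) ?_
        have hP0 : 0 ≤ P τ x := by simp only [hP]; positivity
        have : m τ x / |τ| ≤ |τ| * |x| ^ 2 := by
          rw [div_le_iff₀ hτ']; nlinarith [hmt τ x]
        have := mul_le_mul_of_nonneg_right this (norm_nonneg (g x))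
        nlinarith [mul_nonneg hlam0.le hP0]
    rw [integral_zero] at hHt
    have hev := (Metric.tendsto_nhds.1 hHt) (ε / 2) (by positivity)
    filter_upwards [hev, self_mem_nhdsWithin] with τ hτ hτ0
    have hHi : Integrable (H τ) := (h.const_mul lam⁻¹).mono' (hHm τ)
      (Eventually.of_forall (hHb τ hτ0))
    rw [Real.dist_eq, sub_zero] at hτ ⊢
    have h0 : 0 ≤ ∫ x, m τ x / |τ| * ‖g x‖ := integral_nonneg fun x =>
      mul_nonneg (div_nonneg (hm0 τ x) (abs_nonneg τ)) (norm_nonneg _)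
    rw [abs_of_nonneg h0]
    calc ∫ x, m τ x / |τ| * ‖g x‖ ≤ ∫ x, (H τ x + lam * P τ x) := by
          refine integral_mono_of_nonneg (Eventually.of_forall fun x =>
            mul_nonneg (div_nonneg (hm0 τ x) (abs_nonneg τ)) (norm_nonneg _))
            (hHi.add ((hPi τ hτ0).1.const_mul lam)) (Eventually.of_forall fun x => ?_)
          have := le_max_right 0 (m τ x / |τ| * ‖g x‖ - lam * P τ x)
          simp only [hH]
          linarith
      _ = (∫ x, H τ x) + lam * (32 * Real.pi) := by
          rw [integral_add hHi ((hPi τ hτ0).1.const_mul lam), integral_const_mul, (hPi τ hτ0).2]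
      _ < ε / 2 + lam * (32 * Real.pi) := by
          have := (le_abs_self _).trans_lt hτ
          linarith
      _ = ε := by rw [hlam]; field_simp; ring
  rw [Asymptotics.isLittleO_iff]
  intro c hc
  have h2 : Tendsto (fun ξ : ℝ => 2 * Real.pi * ξ) (𝓝[≠] 0) (𝓝[≠] 0) := by
    refine tendsto_nhdsWithin_iff.2 ⟨?_, ?_⟩
    · have : Continuous (fun ξ : ℝ => 2 * Real.pi * ξ) := by fun_prop
      simpa using (this.tendsto 0).mono_left (nhdsWithin_le_nhds (s := {0}ᶜ))
    · filter_upwards [self_mem_nhdsWithin] with ξ hξ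
      exact mul_ne_zero two_pi_pos.ne' hξ
  have hev := (Metric.tendsto_nhds.1 (main.comp h2)) (c / (2 * Real.pi)) (by positivity)
  rw [eventually_nhdsWithin_iff] at hev
  filter_upwards [hev] with ξ hξ
  by_cases h0 : ξ = 0
  · subst h0
    rw [neg_zero, ← two_mul, sub_self]; simp
  have := hξ h0
  rw [Function.comp, Real.dist_eq, sub_zero] at this
  refine (fourier_second_difference hg ξ).trans ?_
  have hb : 0 < |2 * Real.pi * ξ| := abs_pos.2 (mul_ne_zero two_pi_pos.ne' h0)
  have e : ∫ x, (2 - 2 * Real.cos (2 * Real.pi * ξ * x)) * ‖g x‖ =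
      |2 * Real.pi * ξ| * ∫ x, m (2 * Real.pi * ξ) x / |2 * Real.pi * ξ| * ‖g x‖ := by
    rw [← integral_const_mul]
    congr 1; ext x
    simp only [hm]
    field_simp
  rw [e]
  calc _ ≤ |2 * Real.pi * ξ| * (c / (2 * Real.pi)) := by
        gcongr; exact (le_abs_self _).trans this.le
    _ = c * ‖ξ‖ := by
        rw [abs_mul, abs_of_pos two_pi_pos, Real.norm_eq_abs]; field_simp

end OneDimensional

/-! ### Continuous representatives of the transform and their slices -/

section FourierIntegralAt

theorem plane_eta (ζ : Plane) : !₂[ζ 0, ζ 1] = ζ := by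
  ext i; fin_cases i <;> rfl

theorem fourierIntegralAt_eq (g : Plane → ℂ) (ξ η : ℝ) :
    fourierIntegralAt g ξ η = 𝓕 g ((2 * Real.pi)⁻¹ • !₂[ξ, η]) := by
  rw [Real.fourier_eq', fourierIntegralAt]
  congr 1; ext p
  rw [smul_eq_mul, inner_smul_right]
  congr 2
  have : inner ℝ p !₂[ξ, η] = p 0 * ξ + p 1 * η := by
    simp [PiLp.inner_apply, Fin.sum_univ_two, mul_comm]
  rw [this]
  have hpi : (Real.pi : ℂ) ≠ 0 := by exact_mod_cast Real.pi_ne_zero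
  push_cast
  field_simp

theorem continuous_fourierIntegralAt {g : Plane → ℂ} (hg : Integrable g) :
    Continuous (fun q : ℝ × ℝ => fourierIntegralAt g q.1 q.2) := by
  simp only [fourierIntegralAt_eq]
  exact (continuous_fourier_of_integrable hg).comp (continuous_plane.const_smul (2 * Real.pi)⁻¹)

theorem representsHat_fourierIntegralAt {u : L2Plane} (hu : Integrable (u : Plane → ℂ)) :
    RepresentsHat u (fourierIntegralAt u) := by
  have h := (ae_comp_smul_iff (inv_ne_zero two_pi_pos.ne')).2 (fourier_Lp_ae_eq u hu)
  filter_upwards [h] with ζ hζ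
  rw [fourierHat, hζ, fourierIntegralAt_eq, plane_eta]

theorem ae_swap_prod {P : ℝ × ℝ → Prop} (h : ∀ᵐ q ∂((volume : Measure ℝ).prod volume), P q) :
    ∀ᵐ η : ℝ, ∀ᵐ ξ : ℝ, P (ξ, η) := by
  have h' : ∀ᵐ q ∂((volume : Measure ℝ).prod volume), P q.swap := by
    have := (Measure.measurePreserving_swap (μ := (volume : Measure ℝ))
      (ν := (volume : Measure ℝ))).quasiMeasurePreserving
    exact this.ae h
  exact Measure.ae_ae_of_ae_prod h'

/-- For a.e. `η` the given representative and the Fourier integral are both continuous in `ξ` and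
agree a.e., hence agree at `ξ = 0`. Continuity in `η` then removes the exceptional set. -/
theorem fourierIntegralAt_zero_of_hatVanishes {u : L2Plane} (hu : Integrable (u : Plane → ℂ))
    (h : HatVanishesAtZero u) (η : ℝ) : fourierIntegralAt u 0 η = 0 := by
  obtain ⟨G, hG, hG0⟩ := h
  have hc := continuous_fourierIntegralAt hu
  have e : ∀ᵐ ζ : Plane, G (ζ 0) (ζ 1) = fourierIntegralAt u (ζ 0) (ζ 1) :=
    hG.trans (representsHat_fourierIntegralAt hu).symm
  have e2 := ae_swap_prod (ae_plane_iff.2 e)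
  have e3 : (fun η => fourierIntegralAt u 0 η) =ᵐ[volume] fun _ => 0 := by
    filter_upwards [e2, hG0] with η h1 h2
    have c1 : Continuous (fun ξ => fourierIntegralAt u ξ η) :=
      hc.comp (continuous_id.prodMk continuous_const)
    have := (Continuous.ae_eq_iff_eq volume h2.1 c1).1 h1
    rw [← congrFun this 0, h2.2]
  have c2 : Continuous (fun η => fourierIntegralAt u 0 η) :=
    hc.comp (continuous_const.prodMk continuous_id)
  exact congrFun ((Continuous.ae_eq_iff_eq volume c2 continuous_const).1 e3) η

/-- Partial Fourier transform: `f̂(·, η)` is the Fourier transform of a function of `x` which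
inherits the weighted integrability of `f`. -/
theorem exists_slices {u : L2Plane} (hu : Integrable (u : Plane → ℂ)) :
    ∃ g : ℝ → ℝ → ℂ, (∀ η, Integrable fun x => g x η) ∧
      (∀ ξ η, fourierIntegralAt u ξ η = 𝓕 (fun x => g x η) ((2 * Real.pi)⁻¹ * ξ)) ∧
      (∀ᵐ η, Integrable fun x => ‖g x η‖ ^ 2) ∧
      ∀ a b : ℝ, weightedENorm a b u < ∞ →
        ∀ᵐ η, Integrable fun x => |x| ^ (2 * a) * ‖g x η‖ ^ 2 := by
  obtain ⟨g, g1, g2, g3⟩ := exists_partialFourier (integrable_plane_iff.2 hu)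
    (integrable_plane_iff.2 (integrable_norm_sq u))
  have hc : (2 * Real.pi)⁻¹ ≠ 0 := inv_ne_zero two_pi_pos.ne'
  refine ⟨fun x η => g x ((2 * Real.pi)⁻¹ * η), fun η => g1 _, fun ξ η => ?_, ?_, ?_⟩
  · rw [g2, fourierIntegralAt, integral_plane]
    congr 1; ext q
    congr 2
    have hpi : (Real.pi : ℂ) ≠ 0 := by exact_mod_cast Real.pi_ne_zero
    simp only [Matrix.cons_val_zero, Matrix.cons_val_one]
    push_cast
    field_simp
  · have := g3 (fun _ => 1) measurable_const (fun _ => zero_le_one)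
      (by simpa using integrable_plane_iff.2 (integrable_norm_sq u))
    have := (ae_comp_smul_iff hc).2 this
    simpa using this
  · intro a b hab
    have hi : Integrable (fun p : Plane => |p 0| ^ (2 * a) * ‖u p‖ ^ 2) := by
      refine (integrable_weight_of_weightedENorm hab).mono' ?_ (Eventually.of_forall fun p => ?_)
      · refine AEStronglyMeasurable.mul ?_ (integrable_norm_sq u).1
        apply Measurable.aestronglyMeasurable; fun_prop
      · have hX : 0 ≤ |p 0| ^ (2 * a) := Real.rpow_nonneg (abs_nonneg _) _
        have hY : 0 ≤ |p 1| ^ (2 * b) := Real.rpow_nonneg (abs_nonneg _) _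
        rw [Real.norm_of_nonneg (by positivity)]
        gcongr
        linarith
    have := g3 (fun x => |x| ^ (2 * a)) (by fun_prop)
      (fun x => Real.rpow_nonneg (abs_nonneg _) _) (integrable_plane_iff.2 hi)
    exact (ae_comp_smul_iff hc).2 this

theorem ae_contDiff_fourierIntegralAt {u : L2Plane} (hu : Integrable (u : Plane → ℂ)) {a b : ℝ}
    (ha : 3 / 2 < a) (h : weightedENorm a b u < ∞) :
    ∀ᵐ η : ℝ, ContDiff ℝ 1 (fun ξ => fourierIntegralAt u ξ η) := by
  obtain ⟨g, g1, g2, g3, g4⟩ := exists_slices hu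
  filter_upwards [g3, g4 a b h] with η h3 h4
  simp only [g2]
  exact (contDiff_fourier_of_weight (g1 η) ha h3 h4).comp (contDiff_const.mul contDiff_id)

theorem ae_second_difference_isLittleO {u : L2Plane} (hu : Integrable (u : Plane → ℂ)) {b : ℝ}
    (h : weightedENorm (3 / 2) b u < ∞) :
    ∀ᵐ η : ℝ, (fun ξ => fourierIntegralAt u ξ η + fourierIntegralAt u (-ξ) η -
      2 * fourierIntegralAt u 0 η) =o[𝓝 0] fun ξ => ξ := by
  obtain ⟨g, g1, g2, g3, g4⟩ := exists_slices hu
  filter_upwards [g4 _ b h] with η h4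
  have h4' : Integrable fun x => |x| ^ 3 * ‖g x η‖ ^ 2 := by
    refine h4.congr (Eventually.of_forall fun x => ?_)
    simp only
    rw [show (2 * (3 / 2) : ℝ) = ((3 : ℕ) : ℝ) by norm_num, Real.rpow_natCast]
  have key := fourier_second_difference_isLittleO (g1 η) h4'
  have ht : Tendsto (fun ξ : ℝ => (2 * Real.pi)⁻¹ * ξ) (𝓝 0) (𝓝 0) := by
    have : Continuous (fun ξ : ℝ => (2 * Real.pi)⁻¹ * ξ) := by fun_prop
    simpa using this.tendsto 0
  have k2 := key.comp_tendsto ht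
  simp only [g2, mul_neg, mul_zero]
  exact k2.trans_isBigO (Asymptotics.isBigO_const_mul_self _ _ _)

/-- The pointwise product `L² × L² → L¹`. -/
def mulL1 : L2Plane →L[ℂ] L2Plane →L[ℂ] Lp ℂ 1 (volume : Measure Plane) :=
  (ContinuousLinearMap.mul ℂ ℂ).holderL volume 2 2 1

theorem coeFn_mulL1 (f g : L2Plane) : (mulL1 f g : Plane → ℂ) =ᵐ[volume] fun p => f p * g p :=
  (ContinuousLinearMap.mul ℂ ℂ).coeFn_holder f g

/-- The Fourier transform of `f²` depends continuously on `f ∈ L²` and on the frequency. -/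
theorem continuous_fourier_sq :
    Continuous (fun r : L2Plane × Plane => 𝓕 (fun p => r.1 p * r.1 p) r.2) := by
  have hSc : Continuous (fun f : L2Plane => mulL1 f f) :=
    mulL1.continuous.clm_apply continuous_id
  have h2 : Continuous (fun f : L2Plane => Real.Lp.fourierTransformCLM Plane ℂ (mulL1 f f)) :=
    (Real.Lp.fourierTransformCLM Plane ℂ).continuous.comp hSc
  have h3 : Continuous (fun r : L2Plane × Plane =>
      Real.Lp.fourierTransformCLM Plane ℂ (mulL1 r.1 r.1) r.2) :=
    (h2.comp continuous_fst).eval continuous_snd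
  refine h3.congr fun r => ?_
  rw [Real.Lp.fourierTransformCLM_apply, Real.Lp.fourierTransform_apply]
  exact Real.fourier_congr_ae (coeFn_mulL1 r.1 r.1) r.2

theorem continuous_fourierIntegralAt_sq :
    Continuous (fun r : L2Plane × ℝ × ℝ => fourierIntegralAt (fun p => r.1 p ^ 2) r.2.1 r.2.2) := by
  have hc : Continuous (fun r : L2Plane × ℝ × ℝ =>
      ((r.1, (2 * Real.pi)⁻¹ • !₂[r.2.1, r.2.2]) : L2Plane × Plane)) :=
    continuous_fst.prodMk ((continuous_plane.comp continuous_snd).const_smul (2 * Real.pi)⁻¹)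
  refine (Continuous.comp continuous_fourier_sq hc).congr fun r => ?_
  rw [fourierIntegralAt_eq]
  simp only [Function.comp, sq]

theorem hasDerivAt_fourierIntegralAt {u : Plane → ℂ} (hu : Integrable u)
    (hxu : Integrable fun p : Plane => ((p 0 : ℝ) : ℂ) * u p) (η : ℝ) :
    HasDerivAt (fun ξ => fourierIntegralAt u ξ η)
      (fourierIntegralAt (fun p => -Complex.I * (((p 0 : ℝ) : ℂ) * u p)) 0 η) 0 := by
  have nexp : ∀ (ξ : ℝ) (p : Plane),
      ‖Complex.exp (-(Complex.I * ((p 0 * ξ + p 1 * η : ℝ) : ℂ)))‖ = 1 := by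
    intro ξ p
    rw [← mul_neg, ← Complex.ofReal_neg, mul_comm]
    exact Complex.norm_exp_ofReal_mul_I _
  have cexp : ∀ ξ : ℝ, Continuous fun p : Plane =>
      Complex.exp (-(Complex.I * ((p 0 * ξ + p 1 * η : ℝ) : ℂ))) := fun ξ => by fun_prop
  refine (hasDerivAt_integral_of_dominated_loc_of_deriv_le (x₀ := (0 : ℝ)) (s := univ)
    (F := fun (ξ : ℝ) (p : Plane) =>
      Complex.exp (-(Complex.I * ((p 0 * ξ + p 1 * η : ℝ) : ℂ))) * u p)
    (F' := fun (ξ : ℝ) (p : Plane) => Complex.exp (-(Complex.I * ((p 0 * ξ + p 1 * η : ℝ) : ℂ))) *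
      (-Complex.I * (((p 0 : ℝ) : ℂ) * u p)))
    (bound := fun p => ‖((p 0 : ℝ) : ℂ) * u p‖)
    univ_mem ?_ ?_ ?_ ?_ hxu.norm ?_).2
  · exact Eventually.of_forall fun ξ => (cexp ξ).aestronglyMeasurable.mul hu.1
  · exact hu.bdd_mul (c := 1) (cexp 0).aestronglyMeasurable
      (Eventually.of_forall fun p => (nexp 0 p).le)
  · exact (cexp 0).aestronglyMeasurable.mul (hxu.1.const_mul _)
  · refine Eventually.of_forall fun p ξ _ => ?_
    rw [norm_mul, nexp, one_mul, norm_mul, norm_neg, Complex.norm_I, one_mul]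
  · refine Eventually.of_forall fun p ξ _ => ?_
    have h1 : HasDerivAt (fun ξ : ℝ => ((p 0 * ξ + p 1 * η : ℝ) : ℂ)) ((p 0 : ℝ) : ℂ) ξ := by
      have : HasDerivAt (fun ξ : ℝ => p 0 * ξ + p 1 * η) (p 0) ξ := by
        simpa using ((hasDerivAt_id ξ).const_mul (p 0)).add_const (p 1 * η)
      exact this.ofReal_comp
    have := ((h1.const_mul Complex.I).neg.cexp).mul_const (u p)
    refine this.congr_deriv ?_
    simp only [Pi.neg_apply]
    ring

end FourierIntegralAt

/-! ### Matching the one-sided slopes at `ξ = 0` -/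

section JumpCondition

theorem exp_I_sub_exp_neg_I (x : ℝ) :
    Complex.exp (Complex.I * (x : ℂ)) - Complex.exp (-(Complex.I * (x : ℂ))) =
      2 * Complex.I * ((Real.sin x : ℝ) : ℂ) := by
  have := Complex.two_sin (x : ℂ)
  rw [Complex.ofReal_sin]
  rw [show -(Complex.I * (x : ℂ)) = -(x : ℂ) * Complex.I by ring,
    show Complex.I * (x : ℂ) = x * Complex.I by ring]
  have h2 : 2 * Complex.I * Complex.sin (x : ℂ) = Complex.I * (2 * Complex.sin (x : ℂ)) := by ring
  rw [h2, this]
  linear_combination (Complex.exp ((x : ℂ) * Complex.I) - Complex.exp (-(x : ℂ) * Complex.I)) *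
    Complex.I_sq

/-- Absence of a corner at `ξ = 0` for the solution of Duhamel's formula forces a compatibility
condition between the one-sided derivatives. -/
theorem jump_condition {A B : ℝ → ℂ} {q : ℝ → ℝ → ℂ} (hq : Continuous (Function.uncurry q))
    {ω : ℝ → ℝ} (hω : Continuous ω) {t₁ t₂ : ℝ} {d : ℂ} (hA0 : A 0 = 0) (hA : HasDerivAt A d 0)
    (hB : (fun ξ => B ξ + B (-ξ)) =o[𝓝 0] fun ξ : ℝ => ξ)
    (hpos : ∀ ξ : ℝ, 0 < ξ → Complex.exp (-(Complex.I * ((ω ξ * t₂ : ℝ) : ℂ))) * B ξ -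
      Complex.exp (-(Complex.I * ((ω ξ * t₁ : ℝ) : ℂ))) * A ξ =
      ∫ t in t₁..t₂, Complex.exp (-(Complex.I * ((ω ξ * t : ℝ) : ℂ))) *
        (-(Complex.I * ξ / 2) * q t ξ))
    (hneg : ∀ ξ : ℝ, 0 < ξ → Complex.exp (Complex.I * ((ω ξ * t₂ : ℝ) : ℂ)) * B (-ξ) -
      Complex.exp (Complex.I * ((ω ξ * t₁ : ℝ) : ℂ)) * A (-ξ) =
      ∫ t in t₁..t₂, Complex.exp (Complex.I * ((ω ξ * t : ℝ) : ℂ)) *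
        ((Complex.I * ξ / 2) * q t (-ξ))) :
    2 * Complex.I * ((Real.sin (ω 0 * (t₂ - t₁)) : ℝ) : ℂ) * d =
      -∫ t in t₁..t₂, ((Real.sin (ω 0 * (t₂ - t)) : ℝ) : ℂ) * q t 0 := by
  -- `P` and `M` are the Duhamel integrals from `ξ > 0` and from `-ξ`, with phases propagated to
  -- time `t₂`. Both are continuous up to `ξ = 0`, where they differ only through the sign of the
  -- phase.
  set P : ℝ → ℂ := fun ξ =>
    ∫ t in t₁..t₂, Complex.exp (Complex.I * ((ω ξ * (t₂ - t) : ℝ) : ℂ)) * q t ξ with hP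
  set M : ℝ → ℂ := fun ξ =>
    ∫ t in t₁..t₂, Complex.exp (-(Complex.I * ((ω ξ * (t₂ - t) : ℝ) : ℂ))) * q t (-ξ) with hM
  have hqc : Continuous (fun r : ℝ × ℝ => q r.2 r.1) :=
    hq.comp (continuous_snd.prodMk continuous_fst)
  have hqc' : Continuous (fun r : ℝ × ℝ => q r.2 (-r.1)) :=
    hq.comp (continuous_snd.prodMk continuous_fst.neg)
  have hPc : Continuous P :=
    intervalIntegral.continuous_parametric_intervalIntegral_of_continuous' (by
      simp only [Function.uncurry_def]; fun_prop) _ _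
  have hMc : Continuous M :=
    intervalIntegral.continuous_parametric_intervalIntegral_of_continuous' (by
      simp only [Function.uncurry_def]; fun_prop) _ _
  have eB : ∀ ξ : ℝ, 0 < ξ → B ξ = Complex.exp (Complex.I * ((ω ξ * (t₂ - t₁) : ℝ) : ℂ)) * A ξ -
      Complex.I * ξ / 2 * P ξ := by
    intro ξ hξ
    have e : Complex.exp (Complex.I * ((ω ξ * t₂ : ℝ) : ℂ)) * ∫ t in t₁..t₂,
        Complex.exp (-(Complex.I * ((ω ξ * t : ℝ) : ℂ))) * (-(Complex.I * ξ / 2) * q t ξ) =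
        -(Complex.I * ξ / 2) * P ξ := by
      simp only [hP]
      rw [← intervalIntegral.integral_const_mul, ← intervalIntegral.integral_const_mul]
      congr 1; ext t
      have : Complex.exp (Complex.I * ((ω ξ * (t₂ - t) : ℝ) : ℂ)) =
          Complex.exp (Complex.I * ((ω ξ * t₂ : ℝ) : ℂ)) *
          Complex.exp (-(Complex.I * ((ω ξ * t : ℝ) : ℂ))) := by
        rw [← Complex.exp_add]; congr 1; push_cast; ring
      rw [this]; ring
    rw [← hpos ξ hξ, mul_sub, ← mul_assoc, ← mul_assoc, ← Complex.exp_add, ← Complex.exp_add,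
      add_neg_cancel, Complex.exp_zero, one_mul] at e
    have e' : Complex.exp (Complex.I * ((ω ξ * (t₂ - t₁) : ℝ) : ℂ)) =
        Complex.exp (Complex.I * ((ω ξ * t₂ : ℝ) : ℂ) + -(Complex.I * ((ω ξ * t₁ : ℝ) : ℂ))) := by
      congr 1; push_cast; ring
    rw [e']
    linear_combination e
  have eB' : ∀ ξ : ℝ, 0 < ξ →
      B (-ξ) = Complex.exp (-(Complex.I * ((ω ξ * (t₂ - t₁) : ℝ) : ℂ))) * A (-ξ) +
      Complex.I * ξ / 2 * M ξ := by
    intro ξ hξ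
    have e : Complex.exp (-(Complex.I * ((ω ξ * t₂ : ℝ) : ℂ))) * ∫ t in t₁..t₂,
        Complex.exp (Complex.I * ((ω ξ * t : ℝ) : ℂ)) * ((Complex.I * ξ / 2) * q t (-ξ)) =
        (Complex.I * ξ / 2) * M ξ := by
      simp only [hM]
      rw [← intervalIntegral.integral_const_mul, ← intervalIntegral.integral_const_mul]
      congr 1; ext t
      have : Complex.exp (-(Complex.I * ((ω ξ * (t₂ - t) : ℝ) : ℂ))) =
          Complex.exp (-(Complex.I * ((ω ξ * t₂ : ℝ) : ℂ))) *
          Complex.exp (Complex.I * ((ω ξ * t : ℝ) : ℂ)) := by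
        rw [← Complex.exp_add]; congr 1; push_cast; ring
      rw [this]; ring
    rw [← hneg ξ hξ, mul_sub, ← mul_assoc, ← mul_assoc, ← Complex.exp_add, ← Complex.exp_add,
      neg_add_cancel, Complex.exp_zero, one_mul] at e
    have e' : Complex.exp (-(Complex.I * ((ω ξ * (t₂ - t₁) : ℝ) : ℂ))) =
        Complex.exp (-(Complex.I * ((ω ξ * t₂ : ℝ) : ℂ)) + Complex.I * ((ω ξ * t₁ : ℝ) : ℂ)) := by
      congr 1; push_cast; ring
    rw [e']
    linear_combination e
  have tA : Tendsto (fun ξ : ℝ => A ξ / ξ) (𝓝[>] 0) (𝓝 d) := by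
    have := hA.tendsto_slope_zero_right
    refine this.congr fun ξ => ?_
    rw [zero_add, hA0, sub_zero, Complex.real_smul, Complex.ofReal_inv, inv_mul_eq_div]
  have tA' : Tendsto (fun ξ : ℝ => A (-ξ) / ξ) (𝓝[>] 0) (𝓝 (-d)) := by
    have h1 : HasDerivAt (fun ξ => A (-ξ)) (-d) 0 := by
      have : HasDerivAt A d (-0 : ℝ) := by rwa [neg_zero]
      exact (this.scomp (0 : ℝ) (hasDerivAt_neg (0 : ℝ))).congr_deriv (by simp)
    have := h1.tendsto_slope_zero_right
    refine this.congr fun ξ => ?_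
    rw [zero_add, neg_zero, hA0, sub_zero, Complex.real_smul, Complex.ofReal_inv, inv_mul_eq_div]
  have tB : Tendsto (fun ξ : ℝ => (B ξ + B (-ξ)) / (ξ : ℂ)) (𝓝[>] 0) (𝓝 0) := by
    have hB' : (fun ξ => B ξ + B (-ξ)) =o[𝓝[>] 0] fun ξ : ℝ => (ξ : ℂ) :=
      (hB.mono nhdsWithin_le_nhds).trans_isBigO 
        (Asymptotics.IsBigO.of_bound 1 (Eventually.of_forall fun ξ => by simp))
    exact hB'.tendsto_div_nhds_zero
  have cE : Continuous (fun ξ => Complex.exp (Complex.I * ((ω ξ * (t₂ - t₁) : ℝ) : ℂ))) := by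
    fun_prop
  have cE' : Continuous (fun ξ => Complex.exp (-(Complex.I * ((ω ξ * (t₂ - t₁) : ℝ) : ℂ)))) := by
    fun_prop
  have tR : Tendsto (fun ξ : ℝ =>
      Complex.exp (Complex.I * ((ω ξ * (t₂ - t₁) : ℝ) : ℂ)) * (A ξ / ξ) +
      Complex.exp (-(Complex.I * ((ω ξ * (t₂ - t₁) : ℝ) : ℂ))) * (A (-ξ) / ξ) -
      Complex.I / 2 * (P ξ - M ξ)) (𝓝[>] 0)
      (𝓝 (Complex.exp (Complex.I * ((ω 0 * (t₂ - t₁) : ℝ) : ℂ)) * d +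
      Complex.exp (-(Complex.I * ((ω 0 * (t₂ - t₁) : ℝ) : ℂ))) * (-d) -
      Complex.I / 2 * (P 0 - M 0))) := by
    refine Tendsto.sub (Tendsto.add (Tendsto.mul ?_ tA) (Tendsto.mul ?_ tA')) ?_
    · exact (cE.tendsto 0).mono_left nhdsWithin_le_nhds
    · exact (cE'.tendsto 0).mono_left nhdsWithin_le_nhds
    · exact (((hPc.sub hMc).const_mul (Complex.I / 2)).tendsto 0).mono_left nhdsWithin_le_nhds
  -- For `ξ > 0` the expression of `tR` is exactly `(B ξ + B (-ξ)) / ξ`, whose limit is `0`.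
  have tR' := tB.congr' (f₂ := fun ξ : ℝ =>
      Complex.exp (Complex.I * ((ω ξ * (t₂ - t₁) : ℝ) : ℂ)) * (A ξ / ξ) +
      Complex.exp (-(Complex.I * ((ω ξ * (t₂ - t₁) : ℝ) : ℂ))) * (A (-ξ) / ξ) -
      Complex.I / 2 * (P ξ - M ξ)) (by
    filter_upwards [self_mem_nhdsWithin] with ξ hξ
    have hξ0 : (ξ : ℂ) ≠ 0 := by exact_mod_cast (ne_of_gt hξ)
    rw [eB ξ hξ, eB' ξ hξ]
    field_simp
    ring)
  have lim := tendsto_nhds_unique tR tR'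
  have hPM : P 0 - M 0 =
      2 * Complex.I * ∫ t in t₁..t₂, ((Real.sin (ω 0 * (t₂ - t)) : ℝ) : ℂ) * q t 0 := by
    have c0 : Continuous fun t => q t 0 := hq.comp (continuous_id.prodMk continuous_const)
    simp only [hP, hM, neg_zero]
    rw [← intervalIntegral.integral_sub (Continuous.intervalIntegrable (by fun_prop) _ _)
      (Continuous.intervalIntegrable (by fun_prop) _ _), ← intervalIntegral.integral_const_mul]
    congr 1; ext t
    rw [← sub_mul, exp_I_sub_exp_neg_I, mul_assoc]
  have hs := exp_I_sub_exp_neg_I (ω 0 * (t₂ - t₁))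
  rw [hPM] at lim
  rw [← hs]
  linear_combination lim - (∫ t in t₁..t₂, ((Real.sin (ω 0 * (t₂ - t)) : ℝ) : ℂ) * q t 0) *
    Complex.I_sq * (-1)

end JumpCondition

/-! ### The equation and Duhamel's formula in frequency -/

section Solution

theorem measurable_realSign : Measurable Real.sign :=
  Measurable.ite measurableSet_Iio measurable_const
    (Measurable.ite measurableSet_Ioi measurable_const measurable_const)

theorem sign_two_pi_mul (x : ℝ) : Real.sign (2 * Real.pi * x) = Real.sign x := by
  rcases lt_trichotomy x 0 with h | h | h
  · rw [Real.sign_of_neg h, Real.sign_of_neg (mul_neg_of_pos_of_neg two_pi_pos h)]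
  · simp [h]
  · rw [Real.sign_of_pos h, Real.sign_of_pos (mul_pos two_pi_pos h)]

/-- The dispersion relation, in Mathlib's normalization of the Fourier transform. -/
def dispersion (σ : ℝ) (z : Plane) : ℝ :=
  1 + (2 * Real.pi * z 0) ^ 2 - σ * (2 * Real.pi * z 1) ^ 2

theorem continuous_dispersion (σ : ℝ) : Continuous (dispersion σ) := by
  unfold dispersion; fun_prop

theorem dispersion_smul (σ ξ η : ℝ) :
    dispersion σ ((2 * Real.pi)⁻¹ • !₂[ξ, η]) = 1 + ξ ^ 2 - σ * η ^ 2 := by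
  have h := two_pi_pos.ne'
  have e0 : 2 * Real.pi * ((2 * Real.pi)⁻¹ • !₂[ξ, η] : Plane) 0 = ξ := by
    simp only [PiLp.smul_apply, Matrix.cons_val_zero, smul_eq_mul]
    rw [mul_inv_cancel_left₀ h]
  have e1 : 2 * Real.pi * ((2 * Real.pi)⁻¹ • !₂[ξ, η] : Plane) 1 = η := by
    simp only [PiLp.smul_apply, Matrix.cons_val_one, Matrix.cons_val_fin_one, smul_eq_mul]
    rw [mul_inv_cancel_left₀ h]
  rw [dispersion, e0, e1]

theorem IsSolution.continuousOn {σ T : ℝ} {u : ℝ → L2Plane} (hu : IsSolution σ T u) :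
    ContinuousOn u (Icc 0 T) := fun t ht => by
  obtain ⟨_, _, _, _, _, _, _, _, _, _, h⟩ := hu t ht
  exact h.continuousWithinAt

/-- The equation on the Fourier side. -/
theorem IsSolution.hasDerivWithinAt_fourier {σ T : ℝ} {u : ℝ → L2Plane} (hu : IsSolution σ T u)
    {t : ℝ} (ht : t ∈ Icc 0 T) (hi : Integrable (u t : Plane → ℂ)) :
    ∃ v' : L2Plane, HasDerivWithinAt (fun t => (𝓕 (u t) : L2Plane)) v' (Icc 0 T) t ∧
      v' =ᵐ[volume] fun z => Complex.I * ((Real.sign (z 0) * dispersion σ z : ℝ) : ℂ) *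
        (𝓕 (u t) : L2Plane) z +
        -(Real.pi * Complex.I * ((z 0 : ℝ) : ℂ)) * 𝓕 (fun p => u t p * u t p) z := by
  obtain ⟨h, hxx, hyy, ux, uux, h1, h2, h3, h4, h5, h6⟩ := hu t ht
  set Φ : L2Plane →L[ℂ] L2Plane :=
    (Lp.fourierTransformₗᵢ Plane ℂ).toContinuousLinearEquiv.toContinuousLinearMap with hΦ
  have hΦe : ∀ f : L2Plane, Φ f = 𝓕 f := fun f => rfl
  refine ⟨Φ (-(h - hxx + (σ : ℂ) • hyy + uux)), ?_, ?_⟩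
  · exact (Φ.restrictScalars ℝ).hasFDerivAt.comp_hasDerivWithinAt t h6
  have iu : Integrable (uux : Plane → ℂ) := (integrable_coe_mul _ _).congr h5.symm
  have e : Φ (-(h - hxx + (σ : ℂ) • hyy + uux)) =
      -((𝓕 h : L2Plane) - (𝓕 hxx : L2Plane) + (σ : ℂ) • (𝓕 hyy : L2Plane) + (𝓕 uux : L2Plane)) := by
    rw [map_neg, map_add, map_add, map_sub, map_smul]
    simp only [hΦe]
  rw [e]
  filter_upwards [isMultiplierImage_iff.1 h1, isMultiplierImage_iff.1 h2,
    isMultiplierImage_iff.1 h3, fourier_Lp_ae_eq uux iu,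
    Lp.coeFn_neg ((𝓕 h : L2Plane) - (𝓕 hxx : L2Plane) + (σ : ℂ) • (𝓕 hyy : L2Plane) +
      (𝓕 uux : L2Plane)),
    Lp.coeFn_add ((𝓕 h : L2Plane) - (𝓕 hxx : L2Plane) + (σ : ℂ) • (𝓕 hyy : L2Plane))
      (𝓕 uux : L2Plane),
    Lp.coeFn_add ((𝓕 h : L2Plane) - (𝓕 hxx : L2Plane)) ((σ : ℂ) • (𝓕 hyy : L2Plane)),
    Lp.coeFn_sub (𝓕 h : L2Plane) (𝓕 hxx : L2Plane),
    Lp.coeFn_smul (σ : ℂ) (𝓕 hyy : L2Plane)] with z e1 e2 e3 e4 e5 e6 e7 e8 e9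
  rw [e5, Pi.neg_apply, e6, Pi.add_apply, e7, Pi.add_apply, e8, Pi.sub_apply, e9, Pi.smul_apply,
    e1, e2, e3, e4, fourier_coe_mul _ _ h5, fourier_mul_deriv hi h4]
  simp only [hilbertSymbol, derivSymbol, dispersion, PiLp.smul_apply, smul_eq_mul, sign_two_pi_mul]
  push_cast
  linear_combination (-Complex.I * (Real.sign (z 0) : ℂ) * (2 * Real.pi * (z 0 : ℂ)) ^ 2 +
    Complex.I * σ * (Real.sign (z 0) : ℂ) * (2 * Real.pi * (z 1 : ℂ)) ^ 2) *
    (𝓕 (u t) : L2Plane) z * Complex.I_sq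

theorem continuous_phase {θ : Plane → ℝ} (hθ : Continuous θ) :
    Continuous (fun r : Plane × ℝ => phase θ r.2 r.1) := by
  unfold phase; fun_prop

/-- `sgn ξ` makes `θ` discontinuous on the plane, but on an open half plane it agrees with a
continuous phase `θ'`. Both sides are then continuous there, so the a.e. formula holds at every
point; this permits `ξ → 0` at a fixed `η`. -/
theorem eqOn_of_ae_phase {θ θ' : Plane → ℝ} (hθ' : Continuous θ') {U : Set Plane} (hU : IsOpen U)
    (hθ : ∀ z ∈ U, θ z = θ' z) {f₁ f₂ : Plane → ℂ} (h₁ : Continuous f₁) (h₂ : Continuous f₂)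
    {N : ℝ → Plane → ℂ} (hN : Continuous (Function.uncurry N)) {t₁ t₂ : ℝ}
    (h : ∀ᵐ z : Plane, phase θ t₂ z * f₂ z - phase θ t₁ z * f₁ z =
      ∫ t in t₁..t₂, phase θ t z * N t z) {z : Plane} (hz : z ∈ U) :
    phase θ' t₂ z * f₂ z - phase θ' t₁ z * f₁ z = ∫ t in t₁..t₂, phase θ' t z * N t z := by
  have cph := continuous_phase hθ'
  have cph' : ∀ t, Continuous (phase θ' t) := fun t =>
    cph.comp (continuous_id.prodMk continuous_const)
  have hphase : ∀ z ∈ U, ∀ t, phase θ t z = phase θ' t z := fun z hz t => by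
    rw [phase, phase, hθ z hz]
  have hN' : Continuous (fun r : Plane × ℝ => N r.2 r.1) := hN.comp continuous_swap
  have cR : Continuous (fun z => ∫ t in t₁..t₂, phase θ' t z * N t z) :=
    intervalIntegral.continuous_parametric_intervalIntegral_of_continuous' (cph.mul hN') _ _
  have hae : (fun z => phase θ' t₂ z * f₂ z - phase θ' t₁ z * f₁ z) =ᵐ[volume.restrict U]
      fun z => ∫ t in t₁..t₂, phase θ' t z * N t z := by
    rw [EventuallyEq, ae_restrict_iff' hU.measurableSet]
    filter_upwards [h] with z e1 hz
    simpa only [hphase z hz] using e1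
  exact Measure.eqOn_open_of_ae_eq hae hU
    (((cph' t₂).mul h₂).sub ((cph' t₁).mul h₁)).continuousOn cR.continuousOn hz

/-- Duhamel's formula in each of the half planes `{ε ξ > 0}`. -/
theorem IsSolution.duhamel {σ T : ℝ} {u : ℝ → L2Plane} (hu : IsSolution σ T u)
    (hi : ∀ t ∈ Icc 0 T, Integrable (u t : Plane → ℂ)) {t₁ t₂ : ℝ} (h₁ : t₁ ∈ Icc 0 T)
    (h₂ : t₂ ∈ Icc 0 T) (h₁₂ : t₁ ≤ t₂) {ε : ℝ} (hε : ε = 1 ∨ ε = -1) {ξ : ℝ} (hξ : 0 < ε * ξ)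
    (η : ℝ) :
    Complex.exp (-(Complex.I * ((ε * (1 + ξ ^ 2 - σ * η ^ 2) * t₂ : ℝ) : ℂ))) *
        fourierIntegralAt (u t₂) ξ η -
      Complex.exp (-(Complex.I * ((ε * (1 + ξ ^ 2 - σ * η ^ 2) * t₁ : ℝ) : ℂ))) *
        fourierIntegralAt (u t₁) ξ η =
      ∫ t in t₁..t₂, Complex.exp (-(Complex.I * ((ε * (1 + ξ ^ 2 - σ * η ^ 2) * t : ℝ) : ℂ))) *
        (-(Complex.I * ξ / 2) * fourierIntegralAt (fun p => u t p ^ 2) ξ η) := by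
  have hT : (0 : ℝ) ≤ T := h₁.1.trans h₁.2
  -- `u` is only controlled on `[0, T]`; a globally continuous curve makes the forcing term jointly
  -- continuous on `ℝ × Plane`.
  set w : ℝ → L2Plane := IccExtend hT ((Icc 0 T).domRestrict u) with hw
  have hwc : Continuous w := (continuousOn_iff_continuous_domRestrict.1 hu.continuousOn).Icc_extend'
  have hwu : ∀ t ∈ Icc 0 T, w t = u t := fun t ht => by
    rw [hw, IccExtend_of_mem _ _ ht]; rfl
  set N : ℝ → Plane → ℂ := fun t z =>
    -(Real.pi * Complex.I * ((z 0 : ℝ) : ℂ)) * 𝓕 (fun p => w t p * w t p) z with hN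
  have hNc : Continuous (Function.uncurry N) := by
    have h1 : Continuous (fun r : ℝ × Plane => 𝓕 (fun p => w r.1 p * w r.1 p) r.2) :=
      Continuous.comp (f := fun r : ℝ × Plane => ((w r.1, r.2) : L2Plane × Plane))
        continuous_fourier_sq ((hwc.comp continuous_fst).prodMk continuous_snd)
    exact Continuous.mul (by fun_prop) h1
  set θ : Plane → ℝ := fun z => Real.sign (z 0) * dispersion σ z with hθ
  have hθm : Measurable θ :=
    (measurable_realSign.comp (by fun_prop)).mul (continuous_dispersion σ).measurable
  have hθb : ∀ R : ℝ, ∃ C, ∀ z : Plane, ‖z‖ ≤ R → |θ z| ≤ C := by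
    intro R
    obtain ⟨C, hC⟩ := (isCompact_closedBall (0 : Plane) R).exists_bound_of_continuousOn
      (continuous_dispersion σ).continuousOn
    refine ⟨C, fun z hz => ?_⟩
    have h1 : |Real.sign (z 0)| ≤ 1 := by
      rcases Real.sign_apply_eq (z 0) with h | h | h <;> simp [h]
    have h2 := hC z (by simpa using hz)
    rw [hθ, abs_mul]
    calc _ ≤ 1 * |dispersion σ z| := by gcongr
      _ ≤ C := by rw [one_mul]; exact h2
  have hv : ∀ t ∈ Icc 0 T, ∃ v' : L2Plane,
      HasDerivWithinAt (fun t => (𝓕 (u t) : L2Plane)) v' (Icc 0 T) t ∧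
      v' =ᵐ[volume] fun z => Complex.I * θ z * (𝓕 (u t) : L2Plane) z + N t z := by
    intro t ht
    obtain ⟨v', h1, h2⟩ := hu.hasDerivWithinAt_fourier ht (hi t ht)
    refine ⟨v', h1, h2.trans (Eventually.of_forall fun z => ?_)⟩
    simp only [hθ, hN, hwu t ht]
  have hd := duhamel_ae hθm hθb hNc hv h₁ h₂ h₁₂
  set θε : Plane → ℝ := fun z => ε * dispersion σ z with hθε
  have cθε : Continuous θε := continuous_const.mul (continuous_dispersion σ)
  set U : Set Plane := {z | 0 < ε * z 0} with hU
  have hUo : IsOpen U := isOpen_lt continuous_const (by fun_prop)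
  have hθU : ∀ z ∈ U, θ z = θε z := by
    intro z hz
    have : Real.sign (z 0) = ε := by
      rcases hε with rfl | rfl
      · exact Real.sign_of_pos (by simpa [hU] using hz)
      · exact Real.sign_of_neg (by simpa [hU] using hz)
    simp only [hθ, hθε, this]
  have hd' : ∀ᵐ z : Plane, phase θ t₂ z * 𝓕 (u t₂ : Plane → ℂ) z -
      phase θ t₁ z * 𝓕 (u t₁ : Plane → ℂ) z = ∫ t in t₁..t₂, phase θ t z * N t z := by
    filter_upwards [hd, fourier_Lp_ae_eq _ (hi t₁ h₁), fourier_Lp_ae_eq _ (hi t₂ h₂)]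
      with z e1 e2 e3
    rw [← e2, ← e3]
    exact e1
  set z₀ : Plane := (2 * Real.pi)⁻¹ • !₂[ξ, η] with hz₀
  have hz00 : z₀ 0 = (2 * Real.pi)⁻¹ * ξ := by
    simp [hz₀]
  have hzU : z₀ ∈ U := by
    have : (0 : ℝ) < (2 * Real.pi)⁻¹ := inv_pos.2 two_pi_pos
    change 0 < ε * z₀ 0
    rw [hz00]
    nlinarith [mul_pos this hξ]
  have := eqOn_of_ae_phase cθε hUo hθU (continuous_fourier_of_integrable (hi t₁ h₁))
    (continuous_fourier_of_integrable (hi t₂ h₂)) hNc hd' hzU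
  simp only [phase, hθε, hN] at this
  rw [hz₀, dispersion_smul, ← hz₀] at this
  simp only [fourierIntegralAt_eq, ← hz₀]
  rw [this]
  apply intervalIntegral.integral_congr
  intro t ht
  rw [uIcc_of_le h₁₂] at ht
  have htT : t ∈ Icc 0 T := ⟨h₁.1.trans ht.1, ht.2.trans h₂.2⟩
  have hpi : (Real.pi : ℂ) ≠ 0 := by exact_mod_cast Real.pi_ne_zero
  simp only [hwu t htT, hz00, sq]
  push_cast
  field_simp

end Solution

/-! ### The two identities -/

section Main

/-- The extension of a curve on `[0, T]` to a curve on the line, constant outside of `[0, T]`. -/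
theorem IsSolution.exists_continuous_extension {σ T : ℝ} {u : ℝ → L2Plane}
    (hu : IsSolution σ T u) (hT : 0 ≤ T) :
    ∃ w : ℝ → L2Plane, Continuous w ∧ ∀ t ∈ Icc 0 T, w t = u t :=
  ⟨IccExtend hT ((Icc 0 T).domRestrict u),
    (continuousOn_iff_continuous_domRestrict.1 hu.continuousOn).Icc_extend', fun t ht => by
      rw [IccExtend_of_mem _ _ ht]; rfl⟩

theorem continuous_fourierIntegralAt_sq_curve {w : ℝ → L2Plane} (hw : Continuous w) :
    Continuous (fun r : ℝ × ℝ × ℝ => fourierIntegralAt (fun p => w r.1 p ^ 2) r.2.1 r.2.2) :=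
  Continuous.comp (f := fun r : ℝ × ℝ × ℝ => ((w r.1, r.2) : L2Plane × ℝ × ℝ))
    continuous_fourierIntegralAt_sq ((hw.comp continuous_fst).prodMk continuous_snd)

/-- `jump_condition` at a fixed `η`, with `A` and `B` the transforms at `t₁` and `t₂`. Only a
derivative of `A` at `0` enters, so this serves both the `C¹` slices and the case where `x u(t₁)` is
integrable. -/
theorem IsSolution.derivative_identity {σ T : ℝ} {u : ℝ → L2Plane} (hu : IsSolution σ T u)
    (hi : ∀ t ∈ Icc 0 T, Integrable (u t : Plane → ℂ)) {t₁ t₂ : ℝ} (h₁ : t₁ ∈ Icc 0 T)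
    (h₂ : t₂ ∈ Icc 0 T) (h₁₂ : t₁ ≤ t₂) (hv₁ : HatVanishesAtZero (u t₁))
    (hv₂ : HatVanishesAtZero (u t₂)) {b : ℝ} (hw : weightedENorm (3 / 2) b (u t₂) < ∞) :
    ∀ᵐ η : ℝ, ∀ d : ℂ, HasDerivAt (fun ξ => fourierIntegralAt (u t₁) ξ η) d 0 →
      2 * Complex.I * ((Real.sin ((1 - σ * η ^ 2) * (t₂ - t₁)) : ℝ) : ℂ) * d =
        -∫ t' in t₁..t₂, ((Real.sin ((1 - σ * η ^ 2) * (t₂ - t')) : ℝ) : ℂ) *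
          fourierIntegralAt (fun p => (u t' p) ^ 2) 0 η := by
  obtain ⟨w, hwc, hwu⟩ := hu.exists_continuous_extension (h₁.1.trans h₁.2)
  have hmem : ∀ t ∈ uIcc t₁ t₂, w t = u t := fun t ht => by
    rw [uIcc_of_le h₁₂] at ht
    exact hwu t ⟨h₁.1.trans ht.1, ht.2.trans h₂.2⟩
  filter_upwards [ae_second_difference_isLittleO (hi t₂ h₂) hw] with η hη d hd
  have hB0 := fourierIntegralAt_zero_of_hatVanishes (hi t₂ h₂) hv₂ η
  rw [hB0] at hη
  simp only [mul_zero, sub_zero] at hη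
  have hq : Continuous (Function.uncurry fun t ξ : ℝ =>
      fourierIntegralAt (fun p => w t p ^ 2) ξ η) :=
    (continuous_fourierIntegralAt_sq_curve hwc).comp
      (continuous_fst.prodMk (continuous_snd.prodMk continuous_const))
  have key := jump_condition (q := fun t ξ => fourierIntegralAt (fun p => w t p ^ 2) ξ η)
    (B := fun ξ => fourierIntegralAt (u t₂) ξ η) (t₁ := t₁) (t₂ := t₂) hq
    (ω := fun ξ => 1 + ξ ^ 2 - σ * η ^ 2) (by fun_prop)
    (fourierIntegralAt_zero_of_hatVanishes (hi t₁ h₁) hv₁ η) hd hη ?_ ?_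
  · convert key using 2
    · simp
    · apply intervalIntegral.integral_congr
      intro t ht
      simp [hmem t ht]
  · intro ξ hξ
    have := hu.duhamel hi h₁ h₂ h₁₂ (Or.inl rfl) (ξ := ξ) (by simpa using hξ) η
    simp only [one_mul] at this
    rw [this]
    apply intervalIntegral.integral_congr
    intro t ht
    simp only [hmem t ht]
  · intro ξ hξ
    have := hu.duhamel hi h₁ h₂ h₁₂ (Or.inr rfl) (ξ := -ξ) (by simpa using hξ) η
    have e : ∀ t : ℝ, -(Complex.I * ((-1 * (1 + (-ξ) ^ 2 - σ * η ^ 2) * t : ℝ) : ℂ)) =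
        Complex.I * (((1 + ξ ^ 2 - σ * η ^ 2) * t : ℝ) : ℂ) := fun t => by
      push_cast; ring
    simp only [e] at this
    rw [this]
    apply intervalIntegral.integral_congr
    intro t ht
    simp only [hmem t ht]
    push_cast
    ring

theorem continuous_sin_integral {σ : ℝ} {w : ℝ → L2Plane} (hw : Continuous w) (t₁ t₂ : ℝ) :
    Continuous fun η : ℝ => ∫ t' in t₁..t₂,
      ((Real.sin ((1 - σ * η ^ 2) * (t₂ - t')) : ℝ) : ℂ) *
        fourierIntegralAt (fun p => (w t' p) ^ 2) 0 η := by
  apply intervalIntegral.continuous_parametric_intervalIntegral_of_continuous'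
  have h : Continuous (fun r : ℝ × ℝ => fourierIntegralAt (fun p => w r.2 p ^ 2) 0 r.1) :=
    (continuous_fourierIntegralAt_sq_curve hw).comp
      (continuous_snd.prodMk (continuous_const.prodMk continuous_fst))
  have h2 : Continuous (fun r : ℝ × ℝ =>
      ((Real.sin ((1 - σ * r.1 ^ 2) * (t₂ - r.2)) : ℝ) : ℂ)) := by fun_prop
  exact h2.mul h

theorem fourierIntegralAt_zero_zero (g : Plane → ℂ) : fourierIntegralAt g 0 0 = ∫ p, g p := by
  simp [fourierIntegralAt]

theorem IsSolution.first_moment_identity {σ T s : ℝ} {u : ℝ → L2Plane} (hu : IsSolution σ T u)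
    (hs : 1 < s) (hi : ∀ t ∈ Icc 0 T, Integrable (u t : Plane → ℂ))
    (hsob : ∀ t ∈ Icc 0 T, sobolevENorm s (u t) < ∞) {t₁ t₂ : ℝ} (h₁ : t₁ ∈ Icc 0 T)
    (h₂ : t₂ ∈ Icc 0 T) (h₁₂ : t₁ ≤ t₂) (hv₁ : HatVanishesAtZero (u t₁))
    (hv₂ : HatVanishesAtZero (u t₂)) {b : ℝ} (hw : weightedENorm (3 / 2) b (u t₂) < ∞)
    (hx : Integrable (fun p : Plane => ((p 0 : ℝ) : ℂ) * u t₁ p)) :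
    2 * ((Real.sin (t₂ - t₁) : ℝ) : ℂ) * ∫ p : Plane, ((p 0 : ℝ) : ℂ) * u t₁ p =
      ((Real.cos (t₂ - t₁) - 1 : ℝ) : ℂ) * ∫ p : Plane, (u 0 p) ^ 2 := by
  obtain ⟨w, hwc, hwu⟩ := hu.exists_continuous_extension (h₁.1.trans h₁.2)
  have hmem : ∀ t ∈ uIcc t₁ t₂, t ∈ Icc 0 T := fun t ht => by
    rw [uIcc_of_le h₁₂] at ht
    exact ⟨h₁.1.trans ht.1, ht.2.trans h₂.2⟩
  set d : ℝ → ℂ := fun η =>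
    fourierIntegralAt (fun p => -Complex.I * (((p 0 : ℝ) : ℂ) * u t₁ p)) 0 η with hd
  have hdc : Continuous d := (continuous_fourierIntegralAt (hx.const_mul (-Complex.I))).comp
    (continuous_const.prodMk continuous_id)
  have hae : (fun η : ℝ => 2 * Complex.I *
      ((Real.sin ((1 - σ * η ^ 2) * (t₂ - t₁)) : ℝ) : ℂ) * d η) =ᵐ[volume] fun η =>
      -∫ t' in t₁..t₂, ((Real.sin ((1 - σ * η ^ 2) * (t₂ - t')) : ℝ) : ℂ) *
        fourierIntegralAt (fun p => (w t' p) ^ 2) 0 η := by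
    filter_upwards [hu.derivative_identity hi h₁ h₂ h₁₂ hv₁ hv₂ hw] with η hη
    rw [hη (d η) (hasDerivAt_fourierIntegralAt (hi t₁ h₁) hx η)]
    congr 1
    apply intervalIntegral.integral_congr
    intro t ht
    simp only [hwu t (hmem t ht)]
  have hc : Continuous (fun η : ℝ => 2 * Complex.I *
      ((Real.sin ((1 - σ * η ^ 2) * (t₂ - t₁)) : ℝ) : ℂ) * d η) :=
    Continuous.mul (by fun_prop) hdc
  -- An a.e. identity between continuous functions of `η` holds everywhere, in particular at `η =
  -- 0`.
  have heq := congrFun ((Continuous.ae_eq_iff_eq volume hc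
    (continuous_sin_integral hwc t₁ t₂).neg).1 hae) 0
  have hQ : ∫ t' in t₁..t₂, ((Real.sin ((1 - σ * 0 ^ 2) * (t₂ - t')) : ℝ) : ℂ) *
      fourierIntegralAt (fun p => (w t' p) ^ 2) 0 0 =
      ((1 - Real.cos (t₂ - t₁) : ℝ) : ℂ) * ∫ p : Plane, (u 0 p) ^ 2 := by
    have e : ∫ t' in t₁..t₂, ((Real.sin ((1 - σ * 0 ^ 2) * (t₂ - t')) : ℝ) : ℂ) *
      fourierIntegralAt (fun p => (w t' p) ^ 2) 0 0 =
      ∫ t' in t₁..t₂, ((Real.sin (t₂ - t') : ℝ) : ℂ) * ∫ p : Plane, (u 0 p) ^ 2 := by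
      apply intervalIntegral.integral_congr
      intro t ht
      simp only [hwu t (hmem t ht), fourierIntegralAt_zero_zero]
      have := hu.integral_sq_eq hs hi hsob (hmem t ht)
      simp only [sq, this]
      norm_num
    rw [e, intervalIntegral.integral_mul_const]
    congr 1
    rw [intervalIntegral.integral_ofReal, intervalIntegral.integral_comp_sub_left (fun x => Real.sin x) t₂]
    simp
  rw [Pi.neg_apply, hQ] at heq
  simp only [hd, fourierIntegralAt_zero_zero, integral_const_mul] at heq
  norm_num at heq
  push_cast
  linear_combination -heq + 2 * Complex.sin ((t₂ : ℂ) - t₁) *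
    (∫ p : Plane, ((p 0 : ℝ) : ℂ) * u t₁ p) * Complex.I_sq

theorem MemZ.sobolevENorm_lt_top {s a b : ℝ} {f : L2Plane} (h : MemZ s a b f) :
    sobolevENorm s f < ∞ :=
  lt_of_le_of_lt le_self_add h

theorem MemZ.weightedENorm_lt_top {s a b : ℝ} {f : L2Plane} (h : MemZ s a b f) :
    weightedENorm a b f < ∞ :=
  lt_of_le_of_lt le_add_self h

theorem MemZ.integrable {s a b : ℝ} (ha : 1 < a) (hb : 1 < b) {f : L2Plane} (h : MemZ s a b f) :
    Integrable (f : Plane → ℂ) := by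
  -- With `θ = 1/2` the two conditions become exactly `a > 1` and `b > 1`.
  have := integrable_pow_mul_of_weightedENorm (θ := 1 / 2) 0 (by norm_num) (by norm_num)
    (by push_cast; linarith) (by linarith) h.weightedENorm_lt_top
  simpa using this

theorem MemZ.integrable_fst_mul {s a b : ℝ} (ha : 2 < a) (hb : 2 < b) {f : L2Plane}
    (h : MemZ s a b f) : Integrable (fun p : Plane => ((p 0 : ℝ) : ℂ) * f p) := by
  -- The moment in `x` needs `2aθ > 3`; `θ = 3/4` turns the conditions into `a > 2` and `b > 2`.
  have := integrable_pow_mul_of_weightedENorm (θ := 3 / 4) 1 (by norm_num) (by norm_num)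
    (by push_cast; linarith) (by linarith) h.weightedENorm_lt_top
  simpa using this

end Main

end

theorem mainTheorem7 (s : ℝ) (hs : 3 < s) :
    ∃ ε₀ : ℝ, 0 < ε₀ ∧
      ∀ (r₁ r₂ : ℝ), 3 / 2 - ε₀ < r₁ → r₁ < 3 / 2 → r₁ ≤ r₂ → r₂ < s →
      ∀ (σ : ℝ), (σ = 1 ∨ σ = -1) →
      ∀ (T : ℝ) (u : ℝ → L2Plane), IsSolution σ T u → ContinuousIntoZDot T s r₁ r₂ u →
      ∀ (t₁ t₂ : ℝ), t₁ ∈ Set.Icc 0 T → t₂ ∈ Set.Icc 0 T → t₁ < t₂ →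
      ∀ (κ : ℝ), 0 < κ → MemZ s (3 / 2 + κ) r₂ (u t₁) → MemZ s (3 / 2) r₂ (u t₂) →
        (∃ g : ℝ → ℂ, HatXiDerivAtZero (u t₁) g ∧
          ∀ᵐ η : ℝ,
            2 * Complex.I * ((Real.sin ((1 - σ * η ^ 2) * (t₂ - t₁)) : ℝ) : ℂ) * g η =
              -∫ t' in t₁..t₂, ((Real.sin ((1 - σ * η ^ 2) * (t₂ - t')) : ℝ) : ℂ) *
                fourierIntegralAt (fun p => (u t' p) ^ 2) 0 η) ∧
        (∀ (ρ₁ ρ₂ : ℝ), 2 < ρ₁ → 2 < ρ₂ → MemZ s ρ₁ ρ₂ (u t₁) →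
          MeasureTheory.Integrable (fun p : Plane => ((p 0 : ℝ) : ℂ) * u t₁ p) ∧
          2 * ((Real.sin (t₂ - t₁) : ℝ) : ℂ) * ∫ p : Plane, ((p 0 : ℝ) : ℂ) * u t₁ p =
            ((Real.cos (t₂ - t₁) - 1 : ℝ) : ℂ) * ∫ p : Plane, (u 0 p) ^ 2) := by
  -- `ε₀ = 1/2` gives `r₂ ≥ r₁ > 1`, which makes every `u t` with `t ∈ [0, T]` integrable.
  refine ⟨1 / 2, by norm_num, ?_⟩
  intro r₁ r₂ hr hr' hr₁₂ hr₂ σ hσ T u hu hc t₁ t₂ h₁ h₂ h₁₂ κ hκ hm₁ hm₂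
  have hi : ∀ t ∈ Icc 0 T, Integrable (u t : Plane → ℂ) := fun t ht =>
    (hc t ht).1.1.integrable (by linarith) (by linarith)
  have hv := fun t ht => (hc t ht).1.2
  have hw := hm₂.weightedENorm_lt_top
  refine ⟨⟨fun η => deriv (fun ξ => fourierIntegralAt (u t₁) ξ η) 0,
    ⟨fourierIntegralAt (u t₁), representsHat_fourierIntegralAt (hi t₁ h₁), ?_⟩, ?_⟩, ?_⟩
  · filter_upwards [ae_contDiff_fourierIntegralAt (hi t₁ h₁) (by linarith)
      hm₁.weightedENorm_lt_top] with η hη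
    exact ⟨hη, rfl⟩
  · filter_upwards [ae_contDiff_fourierIntegralAt (hi t₁ h₁) (by linarith)
      hm₁.weightedENorm_lt_top,
      hu.derivative_identity hi h₁ h₂ h₁₂.le (hv t₁ h₁) (hv t₂ h₂) hw] with η hη hη'
    exact hη' _ ((hη.differentiable one_ne_zero) 0).hasDerivAt
  · intro ρ₁ ρ₂ hρ₁ hρ₂ hm
    have hx := hm.integrable_fst_mul hρ₁ hρ₂
    exact ⟨hx, hu.first_moment_identity (by linarith) hi
      (fun t ht => (hc t ht).1.1.sobolevENorm_lt_top) h₁ h₂ h₁₂.le (hv t₁ h₁) (hv t₂ h₂) hw hx⟩
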